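/- Let $r,m,p\ge 0$ be integers, let $\mathbb{C}^+=\{s\in\mathbb{C}:\operatorname{Re}s>0\}$, and let $\mathcal{H}_2=\mathcal{H}_2^{p\times m}(\mathbb{C}^+)$ be the Hardy space of analytic functions $F:\mathbb{C}^+\to\mathbb{C}^{p\times m}$ with $\sup_{\xi>0}\int_{-\infty}^{\infty}\|F(\xi+\imath\omega)\|_F^2\,d\omega<\infty$, with the norm $\|F\|=\sup_{\xi>0}\bigl(\tfrac1{2\pi}\int_{-\infty}^{\infty}\|F(\xi+\imath\omega)\|_F^2\,d\omega\bigr)^{1/2}$ (which equals the norm $\bigl(\tfrac1{2\pi}\int_{-\infty}^{\infty}\|F(\imath\omega)\|_F^2\,d\omega\bigr)^{1/2}$ of the boundary values). Let $\Sigma=\Sigma^-_{r,m,p}(\mathbb{C})$ be the set of functions $s\mapsto \hat C(sI-\hat A)^{-1}\hat B$ on $\mathbb{C}^+$ where $\hat A\in\mathbb{C}^{r\times r}$ is Hurwitz (all eigenvalues in the open left half-plane), $\hat B\in\mathbb{C}^{r\times m}$, $\hat C\in\mathbb{C}^{p\times r}$, and $(\hat A,\hat B,\hat C)$ is minimal,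 i.e. no realization of the same rational function has order less than $r$. For $\hat H\in\Sigma\subset\mathcal{H}_2$ let $\mathrm{T}_{\hat H}\Sigma\subseteq\mathcal{H}_2$ be the tangent space, i.e. the set of all velocities $\gamma'(0)$ of smooth curves $\gamma:(-\varepsilon,\varepsilon)\to\mathcal{H}_2$, $\varepsilon>0$, with $\gamma(0)=\hat H$ and $\gamma(t)\in\Sigma$ for all $t$. Let $\hat H\in\Sigma$ have a pole-residue form $\hat H(s)=\sum_{i=1}^r\frac{c_ib_i^*}{s-\lambda_i}$ for $s\in\mathbb{C}^+$, with $b_i\in\mathbb{C}^m$, $c_i\in\mathbb{C}^p$ and pairwise distinct $\lambda_i\in\mathbb{C}$. Then $\hat H\in\mathcal{H}_2$, and $\mathrm{T}_{\hat H}\Sigma$ is equal to the complex linear span of the functions $$\frac{e_jb_i^*}{s-\lambda_i},\qquad \frac{c_ie_\ell^*}{s-\lambda_i},\qquad \frac{c_ib_i^*}{(s-\lambda_i)^2},\qquad i=1,\dots,r,\ j=1,\dots,p,\ \ell=1,\dots,m,$$ where $e_j$ and $e_\ell$ are the standard basis vectors of $\mathbb{C}^p$ and $\mathbb{C}^m$.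 -/

import Mathlib

open scoped ContDiff

noncomputable section

namespace StableRational

/-! ### The Hardy space of the right half-plane -/

/-- The open right half-plane `ℂ⁺`. -/
def CPlus : Set ℂ := {s | 0 < s.re}

/-- The point `ξ + i y` of `ℂ⁺`, for `ξ > 0`. -/
def vline (ξ : Set.Ioi (0 : ℝ)) (y : ℝ) : CPlus :=
  ⟨(ξ : ℝ) + y * Complex.I, by
    have h : (0 : ℝ) < ξ := ξ.2
    simp only [CPlus, Set.mem_ofPred_eq]
    simpa using h⟩

variable {p m : ℕ}

/-- `F` is analytic on `ℂ⁺`: each entry is holomorphic there. -/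
def IsAnalytic (F : CPlus → Matrix (Fin p) (Fin m) ℂ) : Prop :=
  ∃ G : ℂ → Matrix (Fin p) (Fin m) ℂ,
    (∀ i j, DifferentiableOn ℂ (fun s => G s i j) CPlus) ∧ ∀ s : CPlus, F s = G s

/-- The entries of a matrix as a Euclidean vector, so that `‖frob M‖` is the Frobenius norm
`‖M‖_F`. -/
def frob (M : Matrix (Fin p) (Fin m) ℂ) : EuclideanSpace ℂ (Fin p × Fin m) :=
  WithLp.toLp 2 fun ij => M ij.1 ij.2

/-- `sup_{ξ > 0} (∫ ‖F(ξ + i y)‖_F² dy)^{1/2}`, with values in `[0, ∞]`. -/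
def hardyENorm (F : CPlus → Matrix (Fin p) (Fin m) ℂ) : ENNReal :=
  ⨆ ξ : Set.Ioi (0 : ℝ),
    MeasureTheory.eLpNorm (fun y : ℝ => frob (F (vline ξ y))) 2 MeasureTheory.volume

lemma continuous_vline (ξ : Set.Ioi (0 : ℝ)) : Continuous (vline ξ) := by
  unfold vline
  fun_prop

lemma IsAnalytic.continuous_line {F : CPlus → Matrix (Fin p) (Fin m) ℂ} (hF : IsAnalytic F)
    (ξ : Set.Ioi (0 : ℝ)) : Continuous (fun y : ℝ => frob (F (vline ξ y))) := by
  obtain ⟨G, hG, hFG⟩ := hF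
  refine (PiLp.continuous_toLp 2 _).comp (continuous_pi fun ij => ?_)
  have h := continuousOn_iff_continuous_domRestrict.1 (hG ij.1 ij.2).continuousOn
  simp only [hFG]
  exact h.comp (continuous_vline ξ)

lemma hardyENorm_add_le {F G : CPlus → Matrix (Fin p) (Fin m) ℂ} (hF : IsAnalytic F)
    (hG : IsAnalytic G) : hardyENorm (F + G) ≤ hardyENorm F + hardyENorm G := by
  refine iSup_le fun ξ => ?_
  refine (MeasureTheory.eLpNorm_add_le (hF.continuous_line ξ).aestronglyMeasurable
    (hG.continuous_line ξ).aestronglyMeasurable (by norm_num)).trans ?_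
  exact add_le_add (le_iSup (fun ξ : Set.Ioi (0 : ℝ) => MeasureTheory.eLpNorm
      (fun y : ℝ => frob (F (vline ξ y))) 2 MeasureTheory.volume) ξ)
    (le_iSup (fun ξ : Set.Ioi (0 : ℝ) => MeasureTheory.eLpNorm
      (fun y : ℝ => frob (G (vline ξ y))) 2 MeasureTheory.volume) ξ)

lemma hardyENorm_smul (a : ℂ) (F : CPlus → Matrix (Fin p) (Fin m) ℂ) :
    hardyENorm (a • F) = ‖a‖ₑ * hardyENorm F := by
  unfold hardyENorm
  rw [ENNReal.mul_iSup]
  exact iSup_congr fun ξ => MeasureTheory.eLpNorm_const_smul a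
    (fun y : ℝ => frob (F (vline ξ y))) 2 MeasureTheory.volume

lemma hardyENorm_zero : hardyENorm (0 : CPlus → Matrix (Fin p) (Fin m) ℂ) = 0 := by
  simpa using hardyENorm_smul (0 : ℂ) (0 : CPlus → Matrix (Fin p) (Fin m) ℂ)

lemma eq_zero_of_hardyENorm {F : CPlus → Matrix (Fin p) (Fin m) ℂ} (hF : IsAnalytic F)
    (h : hardyENorm F = 0) : F = 0 := by
  funext s
  have hs : 0 < (s : ℂ).re := s.2
  have h1 := (ENNReal.iSup_eq_zero.1 h) ⟨(s : ℂ).re, hs⟩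
  have hc := hF.continuous_line ⟨(s : ℂ).re, hs⟩
  rw [MeasureTheory.eLpNorm_eq_zero_iff hc.aestronglyMeasurable (by norm_num)] at h1
  have h2 := (hc.ae_eq_iff_eq (g := 0) MeasureTheory.volume continuous_zero).1 h1
  have h3 := congrFun h2 (s : ℂ).im
  have h4 : vline ⟨(s : ℂ).re, hs⟩ (s : ℂ).im = s := by
    apply Subtype.ext
    simp [vline, Complex.re_add_im]
  rw [h4] at h3
  ext i j
  exact congrArg (fun v : EuclideanSpace ℂ (Fin p × Fin m) => v (i, j)) h3

/-- The vector space of the analytic functions `F : ℂ⁺ → ℂ^{p × m}` with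
`sup_{ξ > 0} ∫ ‖F(ξ + i y)‖_F² dy < ∞`. -/
def hardySubmodule (p m : ℕ) : Submodule ℂ (CPlus → Matrix (Fin p) (Fin m) ℂ) where
  carrier := {F | IsAnalytic F ∧ hardyENorm F < ⊤}
  zero_mem' := ⟨⟨0, fun _ _ => differentiableOn_const 0, fun _ => rfl⟩, by simp [hardyENorm_zero]⟩
  add_mem' := by
    rintro F G ⟨hF, hF'⟩ ⟨hG, hG'⟩
    refine ⟨?_, (hardyENorm_add_le hF hG).trans_lt (ENNReal.add_lt_top.2 ⟨hF', hG'⟩)⟩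
    obtain ⟨F₁, hF₁, e₁⟩ := hF
    obtain ⟨G₁, hG₁, e₂⟩ := hG
    exact ⟨F₁ + G₁, fun i j => (hF₁ i j).add (hG₁ i j), fun s => by simp [e₁, e₂]⟩
  smul_mem' := by
    rintro a F ⟨hF, hF'⟩
    refine ⟨?_, ?_⟩
    · obtain ⟨F₁, hF₁, e₁⟩ := hF
      exact ⟨a • F₁, fun i j => (hF₁ i j).const_smul a, fun s => by simp [e₁]⟩
    · rw [hardyENorm_smul]
      exact ENNReal.mul_lt_top (by simp) hF'

/-- The Hardy space `H₂^{p × m}(ℂ⁺)`, as a type of its own: its topology is the one of the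
Hardy norm, not the one of pointwise convergence. -/
def HardyH2 (p m : ℕ) : Type := hardySubmodule p m

instance : AddCommGroup (HardyH2 p m) := inferInstanceAs (AddCommGroup (hardySubmodule p m))

instance : Module ℂ (HardyH2 p m) := inferInstanceAs (Module ℂ (hardySubmodule p m))

/-- The function `ℂ⁺ → ℂ^{p × m}` underlying an element of the Hardy space. -/
def HardyH2.toFun (F : HardyH2 p m) : CPlus → Matrix (Fin p) (Fin m) ℂ := Subtype.val F

lemma HardyH2.isAnalytic (F : HardyH2 p m) : IsAnalytic F.toFun := (Subtype.prop F).1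

lemma HardyH2.hardyENorm_lt_top (F : HardyH2 p m) : hardyENorm F.toFun < ⊤ := (Subtype.prop F).2

/-- The Hardy norm `sup_{ξ > 0} ((2π)⁻¹ ∫ ‖F(ξ + i y)‖_F² dy)^{1/2}`. It equals
`((2π)⁻¹ ∫ ‖F(i y)‖_F² dy)^{1/2}`, where `F(i y)` stands for the boundary values of `F`. -/
instance : Norm (HardyH2 p m) :=
  ⟨fun F => (Real.sqrt (2 * Real.pi))⁻¹ * (hardyENorm F.toFun).toReal⟩

lemma hardyNormCore (p m : ℕ) : NormedSpace.Core ℂ (HardyH2 p m) where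
  norm_nonneg F := mul_nonneg (by positivity) ENNReal.toReal_nonneg
  norm_smul a F := by
    change _ * (hardyENorm (a • F.toFun)).toReal = _ * (_ * (hardyENorm F.toFun).toReal)
    rw [hardyENorm_smul, ENNReal.toReal_mul, toReal_enorm]
    ring
  norm_triangle F G := by
    change _ * (hardyENorm (F.toFun + G.toFun)).toReal ≤
      _ * (hardyENorm F.toFun).toReal + _ * (hardyENorm G.toFun).toReal
    rw [← mul_add, ← ENNReal.toReal_add F.hardyENorm_lt_top.ne G.hardyENorm_lt_top.ne]
    exact mul_le_mul_of_nonneg_left (ENNReal.toReal_mono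
      (ENNReal.add_lt_top.2 ⟨F.hardyENorm_lt_top, G.hardyENorm_lt_top⟩).ne (hardyENorm_add_le F.isAnalytic G.isAnalytic)) (by positivity)
  norm_eq_zero_iff F := by
    change (Real.sqrt (2 * Real.pi))⁻¹ * (hardyENorm F.toFun).toReal = 0 ↔ _
    have hpi : (Real.sqrt (2 * Real.pi))⁻¹ ≠ 0 := by positivity
    rw [mul_eq_zero, or_iff_right hpi, ENNReal.toReal_eq_zero_iff, or_iff_left F.hardyENorm_lt_top.ne]
    constructor
    · intro h
      exact Subtype.ext (eq_zero_of_hardyENorm F.isAnalytic h)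
    · rintro rfl
      exact hardyENorm_zero

instance : NormedAddCommGroup (HardyH2 p m) := NormedAddCommGroup.ofCore (hardyNormCore p m)

instance : NormedSpace ℂ (HardyH2 p m) := NormedSpace.ofCore (hardyNormCore p m)

/-! ### Stable rational functions of order `r` -/

/-- `C (s I - A)⁻¹ B`; meaningful where `s` is not an eigenvalue of `A`. -/
def transfer {r : ℕ} (A : Matrix (Fin r) (Fin r) ℂ) (B : Matrix (Fin r) (Fin m) ℂ)
    (C : Matrix (Fin p) (Fin r) ℂ) (s : ℂ) : Matrix (Fin p) (Fin m) ℂ :=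
  C * (s • (1 : Matrix (Fin r) (Fin r) ℂ) - A)⁻¹ * B

/-- All eigenvalues lie in the open left half-plane. -/
def IsHurwitz {r : ℕ} (A : Matrix (Fin r) (Fin r) ℂ) : Prop :=
  ∀ z ∈ spectrum ℂ A, z.re < 0

/-- `(A, B, C)` has the least order among all realizations of its transfer function. Two
realizations have the same transfer function if the two functions agree off their poles. -/
def IsMinimal {r : ℕ} (A : Matrix (Fin r) (Fin r) ℂ) (B : Matrix (Fin r) (Fin m) ℂ)
    (C : Matrix (Fin p) (Fin r) ℂ) : Prop :=
  ∀ (k : ℕ) (A' : Matrix (Fin k) (Fin k) ℂ) (B' : Matrix (Fin k) (Fin m) ℂ)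
    (C' : Matrix (Fin p) (Fin k) ℂ),
    (∀ s : ℂ, s ∉ spectrum ℂ A → s ∉ spectrum ℂ A' →
      transfer A B C s = transfer A' B' C' s) → r ≤ k

/-- The set `Σ⁻_{r,m,p}(ℂ)` of stable rational functions, as functions on `ℂ⁺`. -/
def stableRat (r m p : ℕ) : Set (CPlus → Matrix (Fin p) (Fin m) ℂ) :=
  {H | ∃ (A : Matrix (Fin r) (Fin r) ℂ) (B : Matrix (Fin r) (Fin m) ℂ)
    (C : Matrix (Fin p) (Fin r) ℂ), IsHurwitz A ∧ IsMinimal A B C ∧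
      ∀ s : CPlus, H s = transfer A B C s}

/-- `Σ⁻_{r,m,p}(ℂ)` as a subset of the Hardy space. -/
def stableRatH2 (r m p : ℕ) : Set (HardyH2 p m) := {H | H.toFun ∈ stableRat r m p}

/-! ### Tangent spaces -/

/-- The tangent space at `x` of an embedded submanifold `M` of a normed space, as a subset of
the ambient space: the velocities `c'(0)` of the smooth curves `c` in `M`, defined on an open
interval around `0`, with `c(0) = x`. -/
def tangentSet {E : Type*} [NormedAddCommGroup E] [NormedSpace ℝ E] (M : Set E) (x : E) :
    Set E :=
  {v | ∃ (ε : ℝ) (c : ℝ → E), 0 < ε ∧ ContDiffOn ℝ ∞ c (Set.Ioo (-ε) ε) ∧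
    (∀ t ∈ Set.Ioo (-ε) ε, c t ∈ M) ∧ c 0 = x ∧ HasDerivAt c v 0}

/-! ### The spanning functions -/

variable {r : ℕ}

/-- `e_j b_i^* / (s - lam_i)` -/
def residueLeft (lam : Fin r → ℂ) (b : Fin r → Fin m → ℂ) (i : Fin r) (j : Fin p) :
    CPlus → Matrix (Fin p) (Fin m) ℂ :=
  fun s => ((s : ℂ) - lam i)⁻¹ • Matrix.vecMulVec (Pi.single j 1) (star (b i))

/-- `c_i e_l^* / (s - lam_i)` -/
def residueRight (lam : Fin r → ℂ) (c : Fin r → Fin p → ℂ) (i : Fin r) (l : Fin m) :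
    CPlus → Matrix (Fin p) (Fin m) ℂ :=
  fun s => ((s : ℂ) - lam i)⁻¹ • Matrix.vecMulVec (c i) (star (Pi.single l 1))

/-- `c_i b_i^* / (s - lam_i)²` -/
def doublePole (lam : Fin r → ℂ) (b : Fin r → Fin m → ℂ) (c : Fin r → Fin p → ℂ) (i : Fin r) :
    CPlus → Matrix (Fin p) (Fin m) ℂ :=
  fun s => (((s : ℂ) - lam i) ^ 2)⁻¹ • Matrix.vecMulVec (c i) (star (b i))

end StableRational

end

noncomputable section

namespace StableRational

variable {p m r : ℕ}

/-! ### Rational functions and their realizations -/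

/-! Minimality of `H` forces every residue `c_i b_i^*` to be nonzero, since dropping a zero term
would lower the order. Each `lam i` is then a genuine pole, hence an eigenvalue of a Hurwitz matrix,
so all poles are stable.

Span into tangent space. Given `x_i`, `y_i`, `a_i`, move the data along `∑ (c_i + t x_i)(b_i + t
y_i)^* / (s - lam_i - t a_i)`. For small `t` the poles stay distinct and stable and the residues
nonzero, so the curve stays in `Σ⁻` (`poleResidue_mem_stableRat`). It is smooth in the Hardy norm
because `z ↦ M / (s - z)` is (`contDiffOn_poleOp`). Its velocity is the general element of the span
(`exists_curve`).

Tangent space into span. No differentiable choice of realizations along the given curve is made.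
Instead each nearby point `F` of the curve is rebuilt from its values at `2r` fixed points: once its
Loewner matrix is invertible, `F(s) = W X(s)⁻¹ V`, with `W`, `V` and the pencil `X(s)` linear in
those values (`eq_rightData_mul_inv_mul_leftData`). Point evaluations are bounded on the Hardy space
(`exists_evalCLM`), so the formula can be differentiated at `t = 0` (`derivative_mul_inv_mul`). At
`t = 0` the realization is diagonal, and with `D = (s - Λ)⁻¹` the velocity becomes `C D P + Q D B -
C D (s X - Y) D B` with constant matrices `P`, `Q`, `X`, `Y`. Partial fractions place this in the
span (`mem_poleSpan_of_eq`). -/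

lemma isUnit_smul_one_sub {k : ℕ} {A : Matrix (Fin k) (Fin k) ℂ} {s : ℂ}
    (hs : s ∉ spectrum ℂ A) : IsUnit (s • (1 : Matrix (Fin k) (Fin k) ℂ) - A) := by
  rw [spectrum.notMem_iff, Algebra.algebraMap_eq_smul_one] at hs
  exact hs

lemma finite_spectrum {k : ℕ} (A : Matrix (Fin k) (Fin k) ℂ) : (spectrum ℂ A).Finite := by
  refine (A.charpoly.roots.toFinset.finite_toSet).subset fun z hz => ?_
  rw [Matrix.mem_spectrum_iff_isRoot_charpoly] at hz
  simpa [A.charpoly_monic.ne_zero] using hz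

lemma eval_charpoly_ne_zero {k : ℕ} {A : Matrix (Fin k) (Fin k) ℂ} {s : ℂ}
    (hs : s ∉ spectrum ℂ A) : A.charpoly.eval s ≠ 0 := by
  rw [Matrix.mem_spectrum_iff_isRoot_charpoly] at hs
  exact hs

/-- The numerator of an entry of a transfer function over the characteristic polynomial. -/
lemma exists_numerator {k : ℕ} (A : Matrix (Fin k) (Fin k) ℂ) (B : Matrix (Fin k) (Fin m) ℂ)
    (C : Matrix (Fin p) (Fin k) ℂ) (j : Fin p) (l : Fin m) :
    ∃ N : Polynomial ℂ, ∀ s ∉ spectrum ℂ A,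
      transfer A B C s j l = N.eval s / A.charpoly.eval s := by
  -- Cramer's rule: the inverse is the adjugate over the determinant, and the adjugate of the
  -- characteristic matrix has polynomial entries.
  refine ⟨(C.map Polynomial.C * (Matrix.charmatrix A).adjugate * B.map Polynomial.C) j l,
    fun s hs => ?_⟩
  have hmap : (Matrix.charmatrix A).map (Polynomial.evalRingHom s)
      = s • (1 : Matrix (Fin k) (Fin k) ℂ) - A := by
    ext a b
    by_cases hab : a = b
    · subst hab; simp
    · simp [hab]
  have hdet : A.charpoly.eval s = (s • (1 : Matrix (Fin k) (Fin k) ℂ) - A).det := by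
    rw [← hmap, Matrix.charpoly]
    exact RingHom.map_det (Polynomial.evalRingHom s) _
  have hadj : (Matrix.charmatrix A).adjugate.map (Polynomial.evalRingHom s)
      = (s • (1 : Matrix (Fin k) (Fin k) ℂ) - A).adjugate := by
    rw [← hmap]
    exact RingHom.map_adjugate (Polynomial.evalRingHom s) _
  have hnum : ((C.map Polynomial.C * (Matrix.charmatrix A).adjugate *
      B.map Polynomial.C) j l).eval s
      = (C * (s • (1 : Matrix (Fin k) (Fin k) ℂ) - A).adjugate * B) j l := by
    rw [← hadj]
    simp [Matrix.mul_apply, Polynomial.eval_finsetSum]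
  rw [hnum, hdet, transfer, Matrix.inv_def, Ring.inverse_eq_inv', Matrix.mul_smul,
    Matrix.smul_mul, Matrix.smul_apply, smul_eq_mul, div_eq_inv_mul]

/-- Two transfer functions that agree on an infinite set agree off their poles. -/
lemma transfer_eq_of_infinite {k k' : ℕ} {A : Matrix (Fin k) (Fin k) ℂ}
    {B : Matrix (Fin k) (Fin m) ℂ} {C : Matrix (Fin p) (Fin k) ℂ}
    {A' : Matrix (Fin k') (Fin k') ℂ} {B' : Matrix (Fin k') (Fin m) ℂ}
    {C' : Matrix (Fin p) (Fin k') ℂ} {S : Set ℂ} (hS : S.Infinite)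
    (h : ∀ s ∈ S, transfer A B C s = transfer A' B' C' s) {s : ℂ}
    (hs : s ∉ spectrum ℂ A) (hs' : s ∉ spectrum ℂ A') :
    transfer A B C s = transfer A' B' C' s := by
  ext j l
  obtain ⟨N, hN⟩ := exists_numerator A B C j l
  obtain ⟨N', hN'⟩ := exists_numerator A' B' C' j l
  -- Cleared of denominators, the agreement is a polynomial identity at infinitely many points,
  -- since discarding the two finite spectra keeps the set infinite.
  have key : N * A'.charpoly = N' * A.charpoly := by
    refine Polynomial.eq_of_infinite_eval_eq _ _
      (((hS.sdiff (finite_spectrum A)).sdiff (finite_spectrum A')).mono ?_)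
    rintro z ⟨⟨hzS, hz⟩, hz'⟩
    have e := congrFun (congrFun (h z hzS) j) l
    rw [hN z hz, hN' z hz', div_eq_div_iff (eval_charpoly_ne_zero hz)
      (eval_charpoly_ne_zero hz')] at e
    simpa using e
  rw [hN s hs, hN' s hs', div_eq_div_iff (eval_charpoly_ne_zero hs) (eval_charpoly_ne_zero hs'),
    ← Polynomial.eval_mul, key, Polynomial.eval_mul]

/-- The input matrix with rows `b_i^*`. -/
def inputMatrix (b : Fin r → Fin m → ℂ) : Matrix (Fin r) (Fin m) ℂ :=
  Matrix.of fun i l => star (b i l)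

/-- The output matrix with columns `c_i`. -/
def outputMatrix (c : Fin r → Fin p → ℂ) : Matrix (Fin p) (Fin r) ℂ :=
  Matrix.of fun j i => c i j

lemma spectrum_diagonal_eq (lam : Fin r → ℂ) :
    spectrum ℂ (Matrix.diagonal lam) = Set.range lam := by
  simp

lemma inv_smul_one_sub_diagonal {lam : Fin r → ℂ} {s : ℂ} (hs : ∀ i, s ≠ lam i) :
    (s • (1 : Matrix (Fin r) (Fin r) ℂ) - Matrix.diagonal lam)⁻¹
      = Matrix.diagonal fun i => (s - lam i)⁻¹ := by
  refine Matrix.inv_eq_right_inv ?_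
  rw [Matrix.smul_one_eq_diagonal, Matrix.diagonal_sub, Matrix.diagonal_mul_diagonal,
    ← Matrix.diagonal_one]
  congr 1
  funext i
  exact mul_inv_cancel₀ (sub_ne_zero.2 (hs i))

lemma transfer_diagonal {lam : Fin r → ℂ} (b : Fin r → Fin m → ℂ) (c : Fin r → Fin p → ℂ) {s : ℂ}
    (hs : ∀ i, s ≠ lam i) :
    transfer (Matrix.diagonal lam) (inputMatrix b) (outputMatrix c) s
      = ∑ i, (s - lam i)⁻¹ • Matrix.vecMulVec (c i) (star (b i)) := by
  rw [transfer, inv_smul_one_sub_diagonal hs]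
  ext j l
  rw [Matrix.mul_apply, Matrix.sum_apply]
  refine Finset.sum_congr rfl fun i _ => ?_
  simp [Matrix.mul_diagonal, inputMatrix, outputMatrix, Matrix.vecMulVec_apply]
  ring

/-! ### Partial fractions with simple poles and Cauchy matrices. -/

/-- The numerator of `∑ w_i / (s - lam_i)` over `∏ (s - lam_i)`. -/
def fracNumerator (lam w : Fin r → ℂ) : Polynomial ℂ :=
  ∑ i, Polynomial.C (w i) * ∏ k ∈ Finset.univ.erase i, (Polynomial.X - Polynomial.C (lam k))

lemma eval_fracNumerator (lam w : Fin r → ℂ) {s : ℂ} (hs : ∀ i, s ≠ lam i) :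
    (fracNumerator lam w).eval s = (∏ i, (s - lam i)) * ∑ i, (s - lam i)⁻¹ * w i := by
  simp only [fracNumerator, Polynomial.eval_finsetSum, Polynomial.eval_mul, Polynomial.eval_C,
    Polynomial.eval_prod, Polynomial.eval_sub, Polynomial.eval_X, Finset.mul_sum]
  refine Finset.sum_congr rfl fun i _ => ?_
  rw [← Finset.mul_prod_erase _ _ (Finset.mem_univ i)]
  have := sub_ne_zero.2 (hs i)
  field_simp

/-- Only the `i`-th summand lacks the factor vanishing at `lam i`, so for distinct poles the
numerator detects each coefficient `w i`. -/
lemma eval_fracNumerator_pole (lam w : Fin r → ℂ) (i : Fin r) :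
    (fracNumerator lam w).eval (lam i) = w i * ∏ k ∈ Finset.univ.erase i, (lam i - lam k) := by
  simp only [fracNumerator, Polynomial.eval_finsetSum, Polynomial.eval_mul, Polynomial.eval_C,
    Polynomial.eval_prod, Polynomial.eval_sub, Polynomial.eval_X]
  refine Finset.sum_eq_single i (fun k _ hk => ?_) (by simp)
  rw [Finset.prod_eq_zero (Finset.mem_erase.2 ⟨hk.symm, Finset.mem_univ i⟩) (sub_self _), mul_zero]

lemma prod_erase_sub_ne_zero {lam : Fin r → ℂ} (hlam : Function.Injective lam) (i : Fin r) :
    ∏ k ∈ Finset.univ.erase i, (lam i - lam k) ≠ 0 := by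
  refine Finset.prod_ne_zero_iff.2 fun k hk => sub_ne_zero.2 fun h => ?_
  exact (Finset.mem_erase.1 hk).1 (hlam h).symm

lemma degree_fracNumerator_lt (lam w : Fin r → ℂ) : (fracNumerator lam w).degree < r := by
  rcases Nat.eq_zero_or_pos r with rfl | hr
  · simp [fracNumerator]
  refine (Polynomial.degree_sum_le _ _).trans_lt ((Finset.sup_lt_iff ?_).2 fun i _ => ?_)
  · exact WithBot.bot_lt_coe r
  · rw [← Polynomial.smul_eq_C_mul]
    refine (Polynomial.degree_smul_le _ _).trans_lt ?_
    rw [Polynomial.degree_prod]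
    simp only [Polynomial.degree_X_sub_C, Finset.sum_const, Finset.card_erase_of_mem
      (Finset.mem_univ i), Finset.card_univ, Fintype.card_fin, nsmul_eq_mul, mul_one]
    exact_mod_cast Nat.sub_lt hr one_pos

/-- The Cauchy matrix of two families of distinct numbers is invertible. -/
lemma isUnit_cauchy {lam sig : Fin r → ℂ} (hlam : Function.Injective lam)
    (hsig : Function.Injective sig) (hne : ∀ i k, sig i ≠ lam k) :
    IsUnit (Matrix.of fun i k => (sig i - lam k)⁻¹) := by
  rw [← Matrix.mulVec_injective_iff_isUnit]
  refine (injective_iff_map_eq_zero (Matrix.mulVecLin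
    (Matrix.of fun i k => (sig i - lam k)⁻¹))).2 fun w hw => ?_
  -- A kernel vector `w` yields a numerator of degree below `r` vanishing at the `r` distinct points
  -- `sig i`.
  have h0 : fracNumerator lam w = 0 := by
    refine Polynomial.eq_zero_of_degree_lt_of_eval_index_eq_zero (v := sig) Finset.univ
      hsig.injOn (by simpa using degree_fracNumerator_lt lam w) fun i _ => ?_
    have := congrFun hw i
    simp only [Matrix.mulVecLin_apply, Matrix.mulVec, dotProduct, Matrix.of_apply,
      Pi.zero_apply] at this
    rw [eval_fracNumerator lam w (hne i), this, mul_zero]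
  funext k
  have := eval_fracNumerator_pole lam w k
  rw [h0, Polynomial.eval_zero] at this
  exact (mul_eq_zero.1 this.symm).resolve_right (prod_erase_sub_ne_zero hlam k)

/-! ### Pole-residue forms and minimality. -/

/-- A pole with nonzero residue is an eigenvalue of every realization. -/
lemma pole_mem_spectrum {k : ℕ} {lam : Fin r → ℂ} (hlam : Function.Injective lam)
    {b : Fin r → Fin m → ℂ} {c : Fin r → Fin p → ℂ} {A : Matrix (Fin k) (Fin k) ℂ}
    {B : Matrix (Fin k) (Fin m) ℂ} {C : Matrix (Fin p) (Fin k) ℂ}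
    (h : ∀ s : ℂ, s ∉ spectrum ℂ (Matrix.diagonal lam) → s ∉ spectrum ℂ A →
      transfer (Matrix.diagonal lam) (inputMatrix b) (outputMatrix c) s = transfer A B C s)
    {i : Fin r} (hb : b i ≠ 0) (hc : c i ≠ 0) : lam i ∈ spectrum ℂ A := by
  obtain ⟨l, hl⟩ := Function.ne_iff.1 hb
  obtain ⟨j, hj⟩ := Function.ne_iff.1 hc
  obtain ⟨N, hN⟩ := exists_numerator A B C j l
  -- At `lam i` the left side vanishes while the numerator on the right does not, so the
  -- characteristic polynomial of `A` must vanish there.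
  have key : N * ∏ i, (Polynomial.X - Polynomial.C (lam i))
      = A.charpoly * fracNumerator lam fun i => c i j * star (b i l) := by
    refine Polynomial.eq_of_infinite_eval_eq _ _
      (((Set.infinite_univ.sdiff (finite_spectrum (Matrix.diagonal lam))).sdiff
        (finite_spectrum A)).mono ?_)
    rintro z ⟨⟨-, hz⟩, hz'⟩
    have hz1 : ∀ i, z ≠ lam i := fun i hi => hz (by simp [hi])
    have e := congrFun (congrFun (h z hz hz') j) l
    rw [hN z hz', transfer_diagonal b c hz1, Matrix.sum_apply] at e
    simp only [Matrix.smul_apply, Matrix.vecMulVec_apply, smul_eq_mul, Pi.star_apply] at e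
    simp only [Set.mem_ofPred_eq, Polynomial.eval_mul, eval_fracNumerator _ _ hz1, e,
      Polynomial.eval_prod, Polynomial.eval_sub, Polynomial.eval_X, Polynomial.eval_C]
    have := eval_charpoly_ne_zero hz'
    field_simp
  have e := congrArg (Polynomial.eval (lam i)) key
  rw [Polynomial.eval_mul, Polynomial.eval_mul, eval_fracNumerator_pole, Polynomial.eval_prod,
    Finset.prod_eq_zero (Finset.mem_univ i) (by simp), mul_zero] at e
  rw [Matrix.mem_spectrum_iff_isRoot_charpoly]
  refine (mul_eq_zero.1 e.symm).resolve_right (mul_ne_zero (mul_ne_zero hj ?_)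
    (prod_erase_sub_ne_zero hlam i))
  simpa using hl

lemma card_le_of_mem_spectrum {k : ℕ} {lam : Fin r → ℂ} (hlam : Function.Injective lam)
    {A : Matrix (Fin k) (Fin k) ℂ} (h : ∀ i, lam i ∈ spectrum ℂ A) : r ≤ k := by
  have h1 : Finset.univ.image lam ⊆ A.charpoly.roots.toFinset := by
    intro z hz
    obtain ⟨i, -, rfl⟩ := Finset.mem_image.1 hz
    have := h i
    rw [Matrix.mem_spectrum_iff_isRoot_charpoly] at this
    simpa [A.charpoly_monic.ne_zero] using this
  have h2 := (Finset.card_le_card h1).trans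
    ((Multiset.toFinset_card_le _).trans (Polynomial.card_roots' _))
  simpa [Finset.card_image_of_injective _ hlam, A.charpoly_natDegree_eq_dim] using h2

lemma ne_of_re_neg {s z : ℂ} (hs : s ∈ CPlus) (hz : z.re < 0) : s ≠ z := by
  rintro rfl
  exact lt_asymm hs hz

/-- A pole-residue form with distinct stable poles and nonzero residues belongs to `Σ⁻`. -/
lemma poleResidue_mem_stableRat {lam : Fin r → ℂ} (hlam : Function.Injective lam)
    (hre : ∀ i, (lam i).re < 0) {b : Fin r → Fin m → ℂ} {c : Fin r → Fin p → ℂ}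
    (hb : ∀ i, b i ≠ 0) (hc : ∀ i, c i ≠ 0) :
    (fun s : CPlus => ∑ i, ((s : ℂ) - lam i)⁻¹ • Matrix.vecMulVec (c i) (star (b i)))
      ∈ stableRat r m p := by
  refine ⟨Matrix.diagonal lam, inputMatrix b, outputMatrix c, ?_, ?_, fun s => ?_⟩
  · intro z hz
    rw [spectrum_diagonal_eq] at hz
    obtain ⟨i, rfl⟩ := hz
    exact hre i
  · intro k A' B' C' h
    exact card_le_of_mem_spectrum hlam fun i => pole_mem_spectrum hlam h (hb i) (hc i)
  · exact (transfer_diagonal b c fun i => ne_of_re_neg s.2 (hre i)).symm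

lemma infinite_CPlus : CPlus.Infinite := by
  refine Set.infinite_of_injective_forall_mem (f := fun n : ℕ => ((n : ℂ) + 1)) ?_ ?_
  · intro a b h
    simpa using h
  · intro n
    change 0 < ((n : ℂ) + 1).re
    simp only [Complex.add_re, Complex.natCast_re, Complex.one_re]
    positivity

/-- A pole-residue form of an element of `Σ⁻_r` with `r` distinct poles has stable poles and
nonzero residues. -/
lemma stable_poles_of_mem_stableRat {H : CPlus → Matrix (Fin p) (Fin m) ℂ}
    (hH : H ∈ stableRat r m p) {lam : Fin r → ℂ} {b : Fin r → Fin m → ℂ} {c : Fin r → Fin p → ℂ}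
    (hlam : Function.Injective lam)
    (hpr : ∀ s : CPlus, H s = ∑ i, ((s : ℂ) - lam i)⁻¹ • Matrix.vecMulVec (c i) (star (b i)))
    (i : Fin r) : (lam i).re < 0 ∧ b i ≠ 0 ∧ c i ≠ 0 := by
  obtain ⟨A, B, C, hA, hmin, hABC⟩ := hH
  -- The poles are not yet known to be stable. At a pole inside `CPlus` the inverse takes the
  -- default value `0`, so such points are removed.
  have hinf : (CPlus \ Set.range lam).Infinite := infinite_CPlus.sdiff (Set.finite_range lam)
  have hne : Matrix.vecMulVec (c i) (star (b i)) ≠ 0 := by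
    intro h0
    -- If the residue at `lam i` were zero, omitting index `i` would give a realization of order `r
    -- - 1`.
    obtain ⟨k, rfl⟩ : ∃ k, r = k + 1 := Nat.exists_eq_succ_of_ne_zero (fun h => by
      subst h; exact i.elim0)
    have := hmin k (Matrix.diagonal (lam ∘ i.succAbove)) (inputMatrix (b ∘ i.succAbove))
      (outputMatrix (c ∘ i.succAbove)) fun s hs hs' => by
        refine transfer_eq_of_infinite hinf (fun z hz => ?_) hs hs'
        have hz1 : ∀ i, z ≠ lam i := fun i hi => hz.2 ⟨i, hi.symm⟩
        rw [transfer_diagonal (lam := lam ∘ i.succAbove) _ _ fun k => hz1 (i.succAbove k), ← hABC ⟨z, hz.1⟩, hpr,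
          Fin.sum_univ_succAbove _ i, h0, smul_zero, zero_add]
        rfl
    omega
  have hb : b i ≠ 0 := by
    intro h
    exact hne (by ext; simp [h, Matrix.vecMulVec_apply])
  have hc : c i ≠ 0 := by
    intro h
    exact hne (by ext; simp [h, Matrix.vecMulVec_apply])
  refine ⟨hA _ (pole_mem_spectrum (B := B) (C := C) hlam (fun s hs hs' =>
    transfer_eq_of_infinite hinf (fun z hz => ?_) hs hs') hb hc), hb, hc⟩
  have hz1 : ∀ i, z ≠ lam i := fun i hi => hz.2 ⟨i, hi.symm⟩
  rw [← hABC ⟨z, hz.1⟩, hpr, transfer_diagonal b c hz1]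

/-! ### Loewner matrices -/

/-- The Loewner matrix of the scalar function `x F y`. -/
def loewner (sig mu : Fin r → CPlus) (x : Fin p → ℂ) (y : Fin m → ℂ)
    (F : CPlus → Matrix (Fin p) (Fin m) ℂ) : Matrix (Fin r) (Fin r) ℂ :=
  Matrix.of fun i j => ((sig i : ℂ) - mu j)⁻¹ *
    (x ⬝ᵥ (F (mu j)).mulVec y - x ⬝ᵥ (F (sig i)).mulVec y)

/-- The Loewner pencil of the scalar function `x F y` at `s`. -/
def loewnerPencil (sig mu : Fin r → CPlus) (x : Fin p → ℂ) (y : Fin m → ℂ)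
    (F : CPlus → Matrix (Fin p) (Fin m) ℂ) (s : ℂ) : Matrix (Fin r) (Fin r) ℂ :=
  Matrix.of fun i j => (s - sig i) * loewner sig mu x y F i j + x ⬝ᵥ (F (mu j)).mulVec y

/-- The rows `x F(sig_i)`. -/
def leftData (sig : Fin r → CPlus) (x : Fin p → ℂ)
    (F : CPlus → Matrix (Fin p) (Fin m) ℂ) : Matrix (Fin r) (Fin m) ℂ :=
  Matrix.of fun i l => Matrix.vecMul x (F (sig i)) l

/-- The columns `F(mu_j) y`. -/
def rightData (mu : Fin r → CPlus) (y : Fin m → ℂ)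
    (F : CPlus → Matrix (Fin p) (Fin m) ℂ) : Matrix (Fin p) (Fin r) ℂ :=
  Matrix.of fun j k => (F (mu k)).mulVec y j

/-- The rows `x C (sig_i - A)⁻¹`. -/
def obsMatrix (sig : Fin r → CPlus) (x : Fin p → ℂ) (A : Matrix (Fin r) (Fin r) ℂ)
    (C : Matrix (Fin p) (Fin r) ℂ) : Matrix (Fin r) (Fin r) ℂ :=
  Matrix.of fun i => Matrix.vecMul x (C * ((sig i : ℂ) • (1 : Matrix (Fin r) (Fin r) ℂ) - A)⁻¹)

/-- The columns `(mu_j - A)⁻¹ B y`. -/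
def ctrlMatrix (mu : Fin r → CPlus) (y : Fin m → ℂ) (A : Matrix (Fin r) (Fin r) ℂ)
    (B : Matrix (Fin r) (Fin m) ℂ) : Matrix (Fin r) (Fin r) ℂ :=
  Matrix.of fun k j =>
    (((mu j : ℂ) • (1 : Matrix (Fin r) (Fin r) ℂ) - A)⁻¹ * B).mulVec y k

/-- Used with `M = 1`, giving the Loewner matrix, and with `M = s - A`, giving the pencil. -/
lemma obsMatrix_mul_mul_ctrlMatrix (sig mu : Fin r → CPlus) (x : Fin p → ℂ) (y : Fin m → ℂ)
    (A : Matrix (Fin r) (Fin r) ℂ) (B : Matrix (Fin r) (Fin m) ℂ) (C : Matrix (Fin p) (Fin r) ℂ)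
    (M : Matrix (Fin r) (Fin r) ℂ) (i j : Fin r) :
    (obsMatrix sig x A C * M * ctrlMatrix mu y A B) i j =
      x ⬝ᵥ (C * (((sig i : ℂ) • (1 : Matrix (Fin r) (Fin r) ℂ) - A)⁻¹ * M *
        ((mu j : ℂ) • (1 : Matrix (Fin r) (Fin r) ℂ) - A)⁻¹) * B).mulVec y := by
  have h : (obsMatrix sig x A C * M * ctrlMatrix mu y A B) i j =
      Matrix.vecMul (Matrix.vecMul x
        (C * ((sig i : ℂ) • (1 : Matrix (Fin r) (Fin r) ℂ) - A)⁻¹)) M ⬝ᵥ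
      (((mu j : ℂ) • (1 : Matrix (Fin r) (Fin r) ℂ) - A)⁻¹ * B).mulVec y := rfl
  rw [h, ← Matrix.dotProduct_mulVec, ← Matrix.dotProduct_mulVec, Matrix.mulVec_mulVec,
    Matrix.mulVec_mulVec]
  simp only [Matrix.mul_assoc]

section realization

variable {A : Matrix (Fin r) (Fin r) ℂ} {B : Matrix (Fin r) (Fin m) ℂ}
  {C : Matrix (Fin p) (Fin r) ℂ} {F : CPlus → Matrix (Fin p) (Fin m) ℂ}

lemma IsHurwitz.isUnit_sub (hA : IsHurwitz A) (s : CPlus) :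
    IsUnit ((s : ℂ) • (1 : Matrix (Fin r) (Fin r) ℂ) - A) :=
  isUnit_smul_one_sub fun h => ne_of_re_neg s.2 (hA _ h) rfl

/-- The resolvent identity. -/
lemma IsHurwitz.resolvent_mul_resolvent (hA : IsHurwitz A) {s z : CPlus} (hsz : (s : ℂ) ≠ z) :
    ((s : ℂ) • (1 : Matrix (Fin r) (Fin r) ℂ) - A)⁻¹ *
      ((z : ℂ) • (1 : Matrix (Fin r) (Fin r) ℂ) - A)⁻¹ =
    ((s : ℂ) - z)⁻¹ • (((z : ℂ) • (1 : Matrix (Fin r) (Fin r) ℂ) - A)⁻¹ -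
      ((s : ℂ) • (1 : Matrix (Fin r) (Fin r) ℂ) - A)⁻¹) := by
  rw [eq_inv_smul_iff₀ (sub_ne_zero.2 hsz)]
  set S := (s : ℂ) • (1 : Matrix (Fin r) (Fin r) ℂ) - A with hS
  set Z := (z : ℂ) • (1 : Matrix (Fin r) (Fin r) ℂ) - A with hZ
  have h1 : S⁻¹ * S = 1 :=
    Matrix.nonsing_inv_mul _ ((Matrix.isUnit_iff_isUnit_det _).1 (hA.isUnit_sub s))
  have h2 : Z * Z⁻¹ = 1 :=
    Matrix.mul_nonsing_inv _ ((Matrix.isUnit_iff_isUnit_det _).1 (hA.isUnit_sub z))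
  have h3 : ((s : ℂ) - z) • (1 : Matrix (Fin r) (Fin r) ℂ) = S - Z := by
    rw [hS, hZ, sub_smul]
    abel
  calc ((s : ℂ) - z) • (S⁻¹ * Z⁻¹)
      = S⁻¹ * (((s : ℂ) - z) • (1 : Matrix (Fin r) (Fin r) ℂ)) * Z⁻¹ := by
        simp
    _ = S⁻¹ * S * Z⁻¹ - S⁻¹ * (Z * Z⁻¹) := by
        rw [h3, Matrix.mul_sub, Matrix.sub_mul, Matrix.mul_assoc S⁻¹ Z]
    _ = Z⁻¹ - S⁻¹ := by rw [h1, h2, Matrix.one_mul, Matrix.mul_one]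

/-- The resolvent identity turns `(sig_i - A)⁻¹ (mu_j - A)⁻¹` into a divided difference. A matrix
computed from values of `F` alone thus factors through any realization. -/
lemma obsMatrix_mul_ctrlMatrix (hA : IsHurwitz A) (hF : ∀ s : CPlus, F s = transfer A B C s)
    {sig mu : Fin r → CPlus} (hne : ∀ i j, (sig i : ℂ) ≠ mu j) (x : Fin p → ℂ) (y : Fin m → ℂ) :
    obsMatrix sig x A C * ctrlMatrix mu y A B = loewner sig mu x y F := by
  ext i j
  have h := obsMatrix_mul_mul_ctrlMatrix sig mu x y A B C 1 i j
  rw [Matrix.mul_one, Matrix.mul_one, hA.resolvent_mul_resolvent (hne i j), Matrix.mul_smul,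
    Matrix.smul_mul, Matrix.smul_mulVec, dotProduct_smul, Matrix.mul_sub, Matrix.sub_mul,
    Matrix.sub_mulVec, dotProduct_sub] at h
  rw [h, loewner, Matrix.of_apply, hF, hF]
  rfl

/-- Write `s - A = (s - sig_i) + (sig_i - A)` in row `i`: the first summand gives a multiple of the
Loewner entry, and the second cancels the left resolvent, leaving `x F(mu_j) y`. -/
lemma obsMatrix_mul_sub_mul_ctrlMatrix (hA : IsHurwitz A)
    (hF : ∀ s : CPlus, F s = transfer A B C s)
    {sig mu : Fin r → CPlus} (hne : ∀ i j, (sig i : ℂ) ≠ mu j) (x : Fin p → ℂ) (y : Fin m → ℂ)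
    (s : ℂ) :
    obsMatrix sig x A C * (s • (1 : Matrix (Fin r) (Fin r) ℂ) - A) * ctrlMatrix mu y A B =
      loewnerPencil sig mu x y F s := by
  ext i j
  have h1 : s • (1 : Matrix (Fin r) (Fin r) ℂ) - A = (s - sig i) • 1 +
      ((sig i : ℂ) • (1 : Matrix (Fin r) (Fin r) ℂ) - A) := by
    rw [sub_smul]
    abel
  rw [h1, Matrix.mul_add, Matrix.add_mul, Matrix.add_apply, obsMatrix_mul_mul_ctrlMatrix,
    obsMatrix_mul_mul_ctrlMatrix, Matrix.nonsing_inv_mul _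
      ((Matrix.isUnit_iff_isUnit_det _).1 (hA.isUnit_sub (sig i))), Matrix.one_mul,
    loewnerPencil, Matrix.of_apply, ← obsMatrix_mul_ctrlMatrix hA hF hne, hF]
  congr 1
  have h := obsMatrix_mul_mul_ctrlMatrix sig mu x y A B C 1 i j
  rw [Matrix.mul_one, Matrix.mul_one] at h
  rw [h, Matrix.mul_smul, Matrix.mul_one, Matrix.smul_mul, Matrix.mul_smul, Matrix.smul_mul,
    Matrix.smul_mulVec, dotProduct_smul, smul_eq_mul]

lemma obsMatrix_mul_input (hF : ∀ s : CPlus, F s = transfer A B C s) (sig : Fin r → CPlus)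
    (x : Fin p → ℂ) : obsMatrix sig x A C * B = leftData sig x F := by
  ext i l
  rw [leftData, Matrix.of_apply, hF, transfer, ← Matrix.vecMul_vecMul]
  rfl

lemma output_mul_ctrlMatrix (hF : ∀ s : CPlus, F s = transfer A B C s) (mu : Fin r → CPlus)
    (y : Fin m → ℂ) : C * ctrlMatrix mu y A B = rightData mu y F := by
  ext j k
  rw [rightData, Matrix.of_apply, hF, transfer, Matrix.mul_assoc, ← Matrix.mulVec_mulVec]
  rfl

/-- A transfer function of order `r` is recovered from an invertible Loewner matrix. -/
lemma eq_rightData_mul_inv_mul_leftData (hA : IsHurwitz A)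
    (hF : ∀ s : CPlus, F s = transfer A B C s)
    {sig mu : Fin r → CPlus} (hne : ∀ i j, (sig i : ℂ) ≠ mu j) {x : Fin p → ℂ} {y : Fin m → ℂ}
    (hL : IsUnit (loewner sig mu x y F)) (s : CPlus) :
    IsUnit (loewnerPencil sig mu x y F s) ∧
      (loewnerPencil sig mu x y F s)⁻¹ = (ctrlMatrix mu y A B)⁻¹ *
        ((s : ℂ) • (1 : Matrix (Fin r) (Fin r) ℂ) - A)⁻¹ * (obsMatrix sig x A C)⁻¹ ∧
      F s = rightData mu y F * (loewnerPencil sig mu x y F s)⁻¹ * leftData sig x F := by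
  rw [← obsMatrix_mul_sub_mul_ctrlMatrix hA hF hne, ← obsMatrix_mul_input hF,
    ← output_mul_ctrlMatrix hF]
  -- Both factors of the Loewner matrix are square, so its invertibility passes to each of them.
  -- They then act as changes of basis that cancel in the formula for `F s`.
  rw [← obsMatrix_mul_ctrlMatrix hA hF hne, Matrix.isUnit_iff_isUnit_det, Matrix.det_mul,
    IsUnit.mul_iff] at hL
  have hS := (Matrix.isUnit_iff_isUnit_det _).1 (hA.isUnit_sub s)
  refine ⟨?_, ?_, ?_⟩
  · rw [Matrix.isUnit_iff_isUnit_det, Matrix.det_mul, Matrix.det_mul]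
    exact (hL.1.mul hS).mul hL.2
  · rw [Matrix.mul_inv_rev, Matrix.mul_inv_rev, Matrix.mul_assoc]
  · rw [Matrix.mul_inv_rev, Matrix.mul_inv_rev, hF, transfer]
    simp only [Matrix.mul_assoc]
    rw [Matrix.mul_nonsing_inv_cancel_left _ _ hL.2, Matrix.nonsing_inv_mul_cancel_left _ _ hL.1]

end realization

/-! ### Differentiation of a Schur complement -/

/-- The slope at `0` is the slope of `a` times `q b`, and `q b` tends to `0`. No differentiability
of `q` is needed. -/
lemma hasDerivAt_mul_mul_zero {a q b : ℝ → ℂ} {a' b' : ℂ} (ha : HasDerivAt a a' 0)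
    (hb : HasDerivAt b b' 0) (hq : ContinuousAt q 0) (ha0 : a 0 = 0) (hb0 : b 0 = 0) :
    HasDerivAt (fun t => a t * q t * b t) 0 0 := by
  rw [hasDerivAt_iff_tendsto_slope] at ha ⊢
  have h := ha.smul ((hq.mul hb.continuousAt).tendsto.mono_left
    (nhdsWithin_le_nhds (s := {(0 : ℝ)}ᶜ)))
  rw [Pi.mul_apply, hb0, mul_zero, smul_zero] at h
  refine h.congr fun t => ?_
  simp only [slope, vsub_eq_sub, ha0, hb0, smul_eq_mul, Complex.real_smul, sub_zero, mul_zero,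
    Pi.mul_apply]
  ring

lemma hasDerivAt_const_matrix_mul {n k l : ℕ} (u : Matrix (Fin n) (Fin k) ℂ)
    {V : ℝ → Matrix (Fin k) (Fin l) ℂ} {V' : Matrix (Fin k) (Fin l) ℂ}
    (hV : ∀ i j, HasDerivAt (fun t => V t i j) (V' i j) 0) (i : Fin n) (j : Fin l) :
    HasDerivAt (fun t => (u * V t) i j) ((u * V') i j) 0 := by
  simp only [Matrix.mul_apply]
  exact HasDerivAt.fun_sum fun a _ => (hV a j).const_mul _

lemma hasDerivAt_matrix_mul_const {n k l : ℕ} (w : Matrix (Fin k) (Fin l) ℂ)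
    {W : ℝ → Matrix (Fin n) (Fin k) ℂ} {W' : Matrix (Fin n) (Fin k) ℂ}
    (hW : ∀ i j, HasDerivAt (fun t => W t i j) (W' i j) 0) (i : Fin n) (j : Fin l) :
    HasDerivAt (fun t => (W t * w) i j) ((W' * w) i j) 0 := by
  simp only [Matrix.mul_apply]
  exact HasDerivAt.fun_sum fun a _ => (hW i a).mul_const _

lemma continuousAt_matrix_inv {X : ℝ → Matrix (Fin r) (Fin r) ℂ}
    (hX : ContinuousAt X 0) (hX0 : IsUnit (X 0)) :
    ContinuousAt (fun t => (X t)⁻¹) 0 := by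
  have hdet : ContinuousAt (fun t => (X t).det) 0 :=
    (continuous_id.matrix_det.continuousAt (x := X 0)).comp hX
  have hadj : ContinuousAt (fun t => (X t).adjugate) 0 :=
    (continuous_id.matrix_adjugate.continuousAt (x := X 0)).comp hX
  simp only [Matrix.inv_def, Ring.inverse_eq_inv']
  exact (hdet.inv₀ ((Matrix.isUnit_iff_isUnit_det _).1 hX0).ne_zero).smul hadj

/-- With `u = W(0) X(0)⁻¹` and `w = X(0)⁻¹ V(0)`, one has `W X⁻¹ V = u V + W w - u X w + (W - u X)
X⁻¹ (V - X w)`. The last term has two factors vanishing at `0`, so its derivative is zero and only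
continuity of `X⁻¹` matters. -/
lemma derivative_mul_inv_mul {W : ℝ → Matrix (Fin p) (Fin r) ℂ}
    {X : ℝ → Matrix (Fin r) (Fin r) ℂ} {V : ℝ → Matrix (Fin r) (Fin m) ℂ}
    {G : ℝ → Matrix (Fin p) (Fin m) ℂ}
    {W' : Matrix (Fin p) (Fin r) ℂ} {X' : Matrix (Fin r) (Fin r) ℂ}
    {V' : Matrix (Fin r) (Fin m) ℂ} {G' : Matrix (Fin p) (Fin m) ℂ}
    (hW : ∀ i j, HasDerivAt (fun t => W t i j) (W' i j) 0)
    (hX : ∀ i j, HasDerivAt (fun t => X t i j) (X' i j) 0)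
    (hV : ∀ i j, HasDerivAt (fun t => V t i j) (V' i j) 0)
    (hG : ∀ i j, HasDerivAt (fun t => G t i j) (G' i j) 0)
    (hX0 : IsUnit (X 0))
    (hE : ∀ᶠ t in nhds (0 : ℝ), IsUnit (X t) ∧ G t = W t * (X t)⁻¹ * V t) :
    G' = W 0 * (X 0)⁻¹ * V' + W' * ((X 0)⁻¹ * V 0) -
      W 0 * (X 0)⁻¹ * X' * ((X 0)⁻¹ * V 0) := by
  ext j l
  have hdet := (Matrix.isUnit_iff_isUnit_det _).1 hX0
  set u := W 0 * (X 0)⁻¹ with hu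
  set w := (X 0)⁻¹ * V 0 with hw
  have hXc : ContinuousAt X 0 :=
    continuousAt_pi.2 fun i => continuousAt_pi.2 fun k => (hX i k).continuousAt
  have hinv := continuousAt_matrix_inv hXc hX0
  have hrem : HasDerivAt (fun t => ((W t - u * X t) * (X t)⁻¹ * (V t - X t * w)) j l) 0 0 := by
    simp only [Matrix.mul_apply, Finset.sum_mul]
    rw [← Finset.sum_const_zero (s := (Finset.univ : Finset (Fin r)))]
    refine HasDerivAt.fun_sum fun a _ => ?_
    rw [← Finset.sum_const_zero (s := (Finset.univ : Finset (Fin r)))]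
    refine HasDerivAt.fun_sum fun d _ => ?_
    refine hasDerivAt_mul_mul_zero ((hW j d).sub (hasDerivAt_const_matrix_mul u hX j d))
      ((hV a l).sub (hasDerivAt_matrix_mul_const w hX a l)) ?_ ?_ ?_
    · exact continuousAt_pi.1 (continuousAt_pi.1 hinv d) a
    · simp [hu, Matrix.mul_assoc, Matrix.nonsing_inv_mul _ hdet]
    · simp [hw, ← Matrix.mul_assoc, Matrix.mul_nonsing_inv _ hdet]
  have hmain := (((hasDerivAt_const_matrix_mul u hV j l).add
    (hasDerivAt_matrix_mul_const w hW j l)).sub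
    (hasDerivAt_matrix_mul_const w (fun i k => hasDerivAt_const_matrix_mul u hX i k) j l)).add hrem
  rw [add_zero] at hmain
  refine ((hG j l).congr_of_eventuallyEq ?_).unique hmain
  filter_upwards [hE] with t ht
  have htd := (Matrix.isUnit_iff_isUnit_det _).1 ht.1
  have e : G t = u * V t + W t * w - u * X t * w +
      (W t - u * X t) * (X t)⁻¹ * (V t - X t * w) := by
    rw [ht.2, Matrix.sub_mul, Matrix.mul_nonsing_inv_cancel_right _ _ htd, Matrix.sub_mul,
      Matrix.mul_sub, Matrix.mul_sub, ← Matrix.mul_assoc (W t * (X t)⁻¹),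
      Matrix.nonsing_inv_mul_cancel_right _ _ htd, Matrix.mul_assoc u (X t) w]
    abel
  rw [e]
  rfl

/-! ### Point evaluations on the Hardy space -/

lemma isOpen_CPlus : IsOpen CPlus := isOpen_lt continuous_const Complex.continuous_re

lemma closedBall_subset_CPlus {s : ℂ} {R : ℝ} (hR : R < s.re) :
    Metric.closedBall s R ⊆ CPlus := by
  intro z hz
  have h1 : ‖z - s‖ ≤ R := by simpa [dist_eq_norm] using hz
  have h2 := (Complex.abs_re_le_norm (z - s)).trans h1
  rw [Complex.sub_re] at h2
  change 0 < z.re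
  linarith [(abs_le.1 h2).1]

open MeasureTheory in
/-- The mean value property on circles, as an inequality. -/
lemma enorm_le_lintegral_circle {g : ℂ → ℂ} {s : ℂ} {ρ : ℝ} (hρ : 0 < ρ)
    (hg : DiffContOnCl ℂ g (Metric.ball s ρ)) :
    ENNReal.ofReal (2 * Real.pi) * ‖g s‖ₑ ≤ ∫⁻ θ in Set.Ioo (-Real.pi) Real.pi,
      ‖g (s + ((ρ * Real.cos θ : ℝ) + (ρ * Real.sin θ : ℝ) * Complex.I))‖ₑ := by
  have h1 : Real.circleAverage g s ρ = g s :=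
    DiffContOnCl.circleAverage (by rwa [abs_of_pos hρ])
  have hper : Function.Periodic (fun θ => g (circleMap s ρ θ)) (2 * Real.pi) := fun θ => by
    simp only [periodic_circleMap s ρ θ]
  have h2 : (2 * Real.pi) • g s = ∫ θ in Set.Ioc (-Real.pi) Real.pi, g (circleMap s ρ θ) := by
    rw [← h1, Real.circleAverage_def, smul_inv_smul₀ (by positivity),
      ← intervalIntegral.integral_of_le (by linarith [Real.pi_pos])]
    -- Shift from `[0, 2π]` to `[-π, π]`, the angular range of `polarCoord`.
    have := hper.intervalIntegral_add_eq 0 (-Real.pi)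
    rw [zero_add, show -Real.pi + 2 * Real.pi = Real.pi by ring] at this
    exact this
  have h3 : ENNReal.ofReal (2 * Real.pi) * ‖g s‖ₑ = ‖(2 * Real.pi) • g s‖ₑ := by
    rw [enorm_smul, Real.enorm_of_nonneg (by positivity)]
  rw [h3, h2, setLIntegral_congr Ioo_ae_eq_Ioc]
  refine (enorm_integral_le_lintegral_enorm _).trans_eq (lintegral_congr fun θ => ?_)
  congr 2
  simp only [circleMap, Complex.exp_mul_I]
  push_cast
  ring

open MeasureTheory in
/-- The mean value property on discs, as an inequality. -/
lemma enorm_le_lintegral_square {g : ℂ → ℂ} (hgm : Measurable g) {s : ℂ} {R : ℝ}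
    (hR : 0 < R) (hg : ∀ ρ, 0 < ρ → ρ < R → DiffContOnCl ℂ g (Metric.ball s ρ)) :
    ENNReal.ofReal (R / 2) * (ENNReal.ofReal (R / 2) * (ENNReal.ofReal (2 * Real.pi) * ‖g s‖ₑ))
      ≤ ∫⁻ x in Set.Ioo (-R) R, ∫⁻ y in Set.Ioo (-R) R,
        ‖g (s + ((x : ℝ) + (y : ℝ) * Complex.I))‖ₑ := by
  set f : ℝ × ℝ → ENNReal := fun q => ‖g (s + ((q.1 : ℝ) + (q.2 : ℝ) * Complex.I))‖ₑ with hf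
  have hfm : Measurable f := by
    refine (hgm.comp ?_).enorm
    exact (by fun_prop : Continuous fun q : ℝ × ℝ =>
      s + ((q.1 : ℝ) + (q.2 : ℝ) * Complex.I)).measurable
  set S : Set (ℝ × ℝ) := Set.Ioo (-R) R ×ˢ Set.Ioo (-R) R with hS
  have hSm : MeasurableSet S := measurableSet_Ioo.prod measurableSet_Ioo
  have hpm : Measurable fun q : ℝ × ℝ => polarCoord.symm q := continuous_polarCoord_symm.measurable
  have h1 : ∫⁻ x in Set.Ioo (-R) R, ∫⁻ y in Set.Ioo (-R) R,
        ‖g (s + ((x : ℝ) + (y : ℝ) * Complex.I))‖ₑ = ∫⁻ q, S.indicator f q := by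
    rw [lintegral_indicator hSm, Measure.volume_eq_prod, hS, setLIntegral_prod _ hfm.aemeasurable]
  have hm2 : Measurable fun q : ℝ × ℝ =>
      ENNReal.ofReal q.1 • S.indicator f (polarCoord.symm q) :=
    (measurable_fst.ennreal_ofReal).mul ((hfm.indicator hSm).comp hpm)
  rw [h1, ← lintegral_comp_polarCoord_symm, polarCoord_target]
  -- Only the radii in `(R/2, R)` are kept: there the Jacobian `ρ` is at least `R/2`, and the
  -- circles lie inside the square. The other factor `R/2` in the bound is the width of this
  -- interval.
  refine le_trans ?_ (lintegral_mono_set (Set.prod_mono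
    (Set.Ioo_subset_Ioi_self.trans (Set.Ioi_subset_Ioi (by positivity : (0 : ℝ) ≤ R / 2)) :
      Set.Ioo (R / 2) R ⊆ Set.Ioi 0) subset_rfl))
  rw [Measure.volume_eq_prod, setLIntegral_prod _ hm2.aemeasurable]
  have hconst : ENNReal.ofReal (R / 2) * (ENNReal.ofReal (R / 2) *
      (ENNReal.ofReal (2 * Real.pi) * ‖g s‖ₑ)) = ∫⁻ _ in Set.Ioo (R / 2) R,
        ENNReal.ofReal (R / 2) * (ENNReal.ofReal (2 * Real.pi) * ‖g s‖ₑ) := by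
    rw [setLIntegral_const, Real.volume_Ioo, show R - R / 2 = R / 2 by ring, mul_comm]
  rw [hconst]
  refine setLIntegral_mono' measurableSet_Ioo fun ρ hρ => ?_
  have hρ0 : 0 < ρ := lt_trans (by positivity) hρ.1
  calc ENNReal.ofReal (R / 2) * (ENNReal.ofReal (2 * Real.pi) * ‖g s‖ₑ)
      ≤ ENNReal.ofReal ρ * ∫⁻ θ in Set.Ioo (-Real.pi) Real.pi,
        ‖g (s + ((ρ * Real.cos θ : ℝ) + (ρ * Real.sin θ : ℝ) * Complex.I))‖ₑ :=
        mul_le_mul' (ENNReal.ofReal_le_ofReal hρ.1.le)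
          (enorm_le_lintegral_circle hρ0 (hg ρ hρ0 hρ.2))
    _ = ∫⁻ θ in Set.Ioo (-Real.pi) Real.pi, ENNReal.ofReal ρ *
        ‖g (s + ((ρ * Real.cos θ : ℝ) + (ρ * Real.sin θ : ℝ) * Complex.I))‖ₑ :=
        (lintegral_const_mul' _ _ ENNReal.ofReal_ne_top).symm
    _ = ∫⁻ θ in Set.Ioo (-Real.pi) Real.pi,
        ENNReal.ofReal ρ • S.indicator f (polarCoord.symm (ρ, θ)) := by
        refine lintegral_congr fun θ => ?_
        have hmem : polarCoord.symm (ρ, θ) ∈ S := by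
          rw [polarCoord_symm_apply, hS, Set.mem_prod, Set.mem_Ioo, Set.mem_Ioo, ← abs_lt,
            ← abs_lt, abs_mul, abs_mul, abs_of_pos hρ0]
          exact ⟨(mul_le_of_le_one_right hρ0.le (Real.abs_cos_le_one θ)).trans_lt hρ.2,
            (mul_le_of_le_one_right hρ0.le (Real.abs_sin_le_one θ)).trans_lt hρ.2⟩
        rw [Set.indicator_of_mem hmem, polarCoord_symm_apply, hf, smul_eq_mul]

-- Cauchy–Schwarz on a segment of length `2R` of a vertical line, where the Hardy norm controls the
-- `L²` norm.
open MeasureTheory in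
lemma lintegral_segment_le_hardyENorm {F : CPlus → Matrix (Fin p) (Fin m) ℂ} (hF : IsAnalytic F)
    (ξ : Set.Ioi (0 : ℝ)) (a R : ℝ) (j : Fin p) (l : Fin m) :
    ∫⁻ y in Set.Ioo (-R) R, ‖F (vline ξ (a + y)) j l‖ₑ ≤
      hardyENorm F * ENNReal.ofReal (2 * R) ^ (1 / 2 : ℝ) := by
  have hc := (hF.continuous_line ξ).comp (continuous_const.add continuous_id : Continuous (a + ·))
  calc ∫⁻ y in Set.Ioo (-R) R, ‖F (vline ξ (a + y)) j l‖ₑ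
      ≤ ∫⁻ y in Set.Ioo (-R) R, ‖frob (F (vline ξ (a + y)))‖ₑ :=
        lintegral_mono fun y => enorm_le_iff_norm_le.2
          (PiLp.norm_apply_le (frob (F (vline ξ (a + y)))) (j, l))
    _ = eLpNorm (fun y => frob (F (vline ξ (a + y)))) 1 (volume.restrict (Set.Ioo (-R) R)) :=
        eLpNorm_one_eq_lintegral_enorm.symm
    _ ≤ eLpNorm (fun y => frob (F (vline ξ (a + y)))) 2 (volume.restrict (Set.Ioo (-R) R)) *
        (volume.restrict (Set.Ioo (-R) R)) Set.univ ^ (1 / (1 : ENNReal).toReal -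
          1 / (2 : ENNReal).toReal) :=
        eLpNorm_le_eLpNorm_mul_rpow_measure_univ (by norm_num) hc.aestronglyMeasurable
    _ ≤ hardyENorm F * ENNReal.ofReal (2 * R) ^ (1 / 2 : ℝ) := by
        refine mul_le_mul' ?_ (le_of_eq ?_)
        · refine (eLpNorm_mono_measure _ Measure.restrict_le_self).trans ?_
          have := eLpNorm_comp_measurePreserving (p := 2) (hF.continuous_line ξ).aestronglyMeasurable
            (measurePreserving_add_left volume a)
          exact this.le.trans (le_iSup (fun ξ : Set.Ioi (0 : ℝ) => eLpNorm
            (fun y : ℝ => frob (F (vline ξ y))) 2 volume) ξ)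
        · rw [Measure.restrict_apply_univ, Real.volume_Ioo, show R - -R = 2 * R by ring]
          congr 1
          norm_num

-- The mean value property bounds the value by an area integral over a square inside `CPlus`, which
-- is then estimated one vertical segment at a time.
open MeasureTheory in
lemma exists_enorm_apply_le (s : CPlus) : ∃ K : NNReal,
    ∀ F : CPlus → Matrix (Fin p) (Fin m) ℂ, IsAnalytic F → ∀ j l,
      ‖F s j l‖ₑ ≤ K * hardyENorm F := by
  classical
  have hs : 0 < (s : ℂ).re := s.2
  set R := (s : ℂ).re / 2 with hRdef
  have hR : 0 < R := by positivity
  set K₁ : ENNReal :=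
    ENNReal.ofReal (R / 2) * (ENNReal.ofReal (R / 2) * ENNReal.ofReal (2 * Real.pi)) with hK₁
  set K₂ : ENNReal := ENNReal.ofReal (2 * R) ^ (1 / 2 : ℝ) * ENNReal.ofReal (2 * R) with hK₂
  have hK₁0 : K₁ ≠ 0 := by
    have : 0 < Real.pi := Real.pi_pos
    simp only [hK₁, ne_eq, mul_eq_zero, ENNReal.ofReal_eq_zero, not_or, not_le]
    exact ⟨by positivity, by positivity, by positivity⟩
  have hK₁t : K₁ ≠ ⊤ := by
    simp only [hK₁]
    finiteness
  have hK₂t : K₂ ≠ ⊤ := by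
    simp only [hK₂]
    finiteness
  refine ⟨(K₂ / K₁).toNNReal, fun F hF j l => ?_⟩
  rw [ENNReal.coe_toNNReal (ENNReal.div_lt_top hK₂t hK₁0).ne]
  obtain ⟨G, hG, hFG⟩ := id hF
  -- Extension by zero makes the function measurable on all of `ℂ`; nothing is known about `G`
  -- outside `CPlus`.
  set g : ℂ → ℂ := CPlus.piecewise (fun z => G z j l) 0 with hg
  have hgm : Measurable g :=
    (hG j l).continuousOn.measurable_piecewise continuousOn_const isOpen_CPlus.measurableSet
  have hgF : ∀ z : CPlus, g z = F z j l := fun z => by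
    rw [hg, Set.piecewise_eq_of_mem _ _ _ z.2, hFG]
  have hgd : DifferentiableOn ℂ g CPlus := (hG j l).congr fun z hz =>
    Set.piecewise_eq_of_mem _ _ _ hz
  have h1 := enorm_le_lintegral_square hgm (s := s) hR fun ρ hρ hρR =>
    hgd.diffContOnCl_ball (closedBall_subset_CPlus (by linarith))
  have h2 : ∫⁻ x in Set.Ioo (-R) R, ∫⁻ y in Set.Ioo (-R) R,
        ‖g (s + ((x : ℝ) + (y : ℝ) * Complex.I))‖ₑ ≤ K₂ * hardyENorm F := by
    calc _ ≤ ∫⁻ _ in Set.Ioo (-R) R, hardyENorm F * ENNReal.ofReal (2 * R) ^ (1 / 2 : ℝ) := by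
          refine setLIntegral_mono' measurableSet_Ioo fun x hx => ?_
          have hξ : (s : ℂ).re + x ∈ Set.Ioi (0 : ℝ) := by
            have := hx.1
            rw [Set.mem_Ioi]
            linarith
          refine le_trans (le_of_eq (lintegral_congr fun y => ?_))
            (lintegral_segment_le_hardyENorm hF ⟨_, hξ⟩ (s : ℂ).im R j l)
          rw [← hgF]
          congr 2
          apply Complex.ext <;> simp [vline]
      _ = K₂ * hardyENorm F := by
          rw [setLIntegral_const, Real.volume_Ioo, hK₂, show R - -R = 2 * R by ring]
          ring
  have h3 : K₁ * ‖F s j l‖ₑ ≤ K₂ * hardyENorm F := by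
    refine le_trans (le_of_eq ?_) (h1.trans h2)
    rw [hK₁, hgF s]
    ring
  rw [ENNReal.div_eq_inv_mul, mul_assoc, ← ENNReal.div_eq_inv_mul,
    ENNReal.le_div_iff_mul_le (Or.inl hK₁0) (Or.inl hK₁t), mul_comm]
  exact h3

lemma HardyH2.norm_def (F : HardyH2 p m) :
    ‖F‖ = (Real.sqrt (2 * Real.pi))⁻¹ * (hardyENorm F.toFun).toReal := rfl

/-- The evaluation of an entry at a point of `ℂ⁺`. -/
lemma exists_evalCLM (s : CPlus) (j : Fin p) (l : Fin m) :
    ∃ φ : HardyH2 p m →L[ℂ] ℂ, ∀ F, φ F = F.toFun s j l := by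
  obtain ⟨K, hK⟩ := exists_enorm_apply_le (p := p) (m := m) s
  let φ : HardyH2 p m →ₗ[ℂ] ℂ :=
    { toFun := fun F => F.toFun s j l
      map_add' := fun _ _ => rfl
      map_smul' := fun _ _ => rfl }
  refine ⟨φ.mkContinuous (K * Real.sqrt (2 * Real.pi)) fun F => ?_, fun F => rfl⟩
  have h := ENNReal.toReal_mono (ENNReal.mul_lt_top ENNReal.coe_lt_top F.hardyENorm_lt_top).ne
    (hK F.toFun F.isAnalytic j l)
  rw [toReal_enorm, ENNReal.toReal_mul, ENNReal.coe_toReal] at h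
  refine h.trans_eq ?_
  have : Real.sqrt (2 * Real.pi) ≠ 0 := by positivity
  rw [HardyH2.norm_def, mul_assoc, mul_inv_cancel_left₀ this]

/-- Differentiability in the Hardy norm passes to entries at a point because evaluation is a bounded
linear functional. -/
lemma hasDerivAt_apply {c : ℝ → HardyH2 p m} {v : HardyH2 p m} (h : HasDerivAt c v 0)
    (s : CPlus) (j : Fin p) (l : Fin m) :
    HasDerivAt (fun t => (c t).toFun s j l) (v.toFun s j l) 0 := by
  obtain ⟨φ, hφ⟩ := exists_evalCLM (p := p) (m := m) s j l
  have := (φ.restrictScalars ℝ).hasFDerivAt.comp_hasDerivAt 0 h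
  simpa [Function.comp_def, hφ] using this

/-! ### Smooth dependence of `M / (s - z)` on the pole `z` -/

@[ext] lemma HardyH2.ext {F G : HardyH2 p m} (h : ∀ s, F.toFun s = G.toFun s) : F = G :=
  Subtype.ext (funext h)

lemma HardyH2.toFun_add (F G : HardyH2 p m) (s : CPlus) :
    (F + G).toFun s = F.toFun s + G.toFun s := rfl

lemma HardyH2.toFun_sub (F G : HardyH2 p m) (s : CPlus) :
    (F - G).toFun s = F.toFun s - G.toFun s := rfl

lemma HardyH2.toFun_smul (a : ℂ) (F : HardyH2 p m) (s : CPlus) :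
    (a • F).toFun s = a • F.toFun s := rfl

/-- The open left half-plane. -/
def leftHalfPlane : Set ℂ := {z | z.re < 0}

lemma isOpen_leftHalfPlane : IsOpen leftHalfPlane :=
  isOpen_lt Complex.continuous_re continuous_const

lemma sub_ne_zero_of_re_neg {z : ℂ} (hz : z ∈ leftHalfPlane) (s : CPlus) : (s : ℂ) - z ≠ 0 :=
  sub_ne_zero.2 (ne_of_re_neg s.2 hz)

lemma norm_inv_sub_le {z : ℂ} (hz : z ∈ leftHalfPlane) (s : CPlus) :
    ‖((s : ℂ) - z)⁻¹‖ ≤ (-z.re)⁻¹ := by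
  have hz' : z.re < 0 := hz
  have hs : 0 < (s : ℂ).re := s.2
  rw [norm_inv]
  refine inv_anti₀ (by linarith) ?_
  refine le_trans ?_ (Complex.re_le_norm _)
  rw [Complex.sub_re]
  linarith

lemma frob_smul (a : ℂ) (M : Matrix (Fin p) (Fin m) ℂ) : frob (a • M) = a • frob M := rfl

lemma IsAnalytic.inv_sub_smul {z : ℂ} (hz : z ∈ leftHalfPlane)
    {F : CPlus → Matrix (Fin p) (Fin m) ℂ} (hF : IsAnalytic F) :
    IsAnalytic fun s => ((s : ℂ) - z)⁻¹ • F s := by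
  obtain ⟨G, hG, hFG⟩ := hF
  refine ⟨fun s => (s - z)⁻¹ • G s, fun i j => ?_, fun s => by simp only [hFG]⟩
  refine DifferentiableOn.mul (DifferentiableOn.inv (by fun_prop) fun s hs => ?_) (hG i j)
  exact sub_ne_zero_of_re_neg hz ⟨s, hs⟩

lemma hardyENorm_inv_sub_smul_le {z : ℂ} (hz : z ∈ leftHalfPlane)
    (F : CPlus → Matrix (Fin p) (Fin m) ℂ) :
    hardyENorm (fun s => ((s : ℂ) - z)⁻¹ • F s) ≤ ENNReal.ofReal (-z.re)⁻¹ * hardyENorm F := by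
  refine iSup_le fun ξ => ?_
  refine le_trans (MeasureTheory.eLpNorm_le_mul_eLpNorm_of_ae_le_mul
    (g := fun y : ℝ => frob (F (vline ξ y))) (c := (-z.re)⁻¹) (.of_forall fun y => ?_) 2)
    (mul_le_mul_right (le_iSup (fun ξ : Set.Ioi (0 : ℝ) => MeasureTheory.eLpNorm
      (fun y : ℝ => frob (F (vline ξ y))) 2 MeasureTheory.volume) ξ) _)
  rw [frob_smul, norm_smul]
  exact mul_le_mul_of_nonneg_right (norm_inv_sub_le hz _) (norm_nonneg _)

/-- Multiplication by `1 / (s - z)`, for `z` in the left half-plane. -/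
def mulPole (z : ℂ) (hz : z ∈ leftHalfPlane) : HardyH2 p m →ₗ[ℂ] HardyH2 p m where
  toFun F := (⟨fun s => ((s : ℂ) - z)⁻¹ • F.toFun s, F.isAnalytic.inv_sub_smul hz,
    (hardyENorm_inv_sub_smul_le hz F.toFun).trans_lt
      (ENNReal.mul_lt_top ENNReal.ofReal_lt_top F.hardyENorm_lt_top)⟩ : hardySubmodule p m)
  map_add' F G := HardyH2.ext fun s => smul_add _ (F.toFun s) (G.toFun s)
  map_smul' a F := HardyH2.ext fun s => smul_comm _ a (F.toFun s)

lemma norm_mulPole_le (z : ℂ) (hz : z ∈ leftHalfPlane) (F : HardyH2 p m) :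
    ‖mulPole z hz F‖ ≤ (-z.re)⁻¹ * ‖F‖ := by
  have hz' : z.re < 0 := hz
  rw [HardyH2.norm_def, HardyH2.norm_def, mul_left_comm]
  refine mul_le_mul_of_nonneg_left ?_ (by positivity)
  have h := ENNReal.toReal_mono (ENNReal.mul_lt_top ENNReal.ofReal_lt_top
    F.hardyENorm_lt_top).ne (hardyENorm_inv_sub_smul_le hz F.toFun)
  rwa [ENNReal.toReal_mul, ENNReal.toReal_ofReal (inv_nonneg.2 (by linarith))] at h

open Classical in
/-- Multiplication by `1 / (s - z)` as a bounded operator, extended by `0` to `Re z ≥ 0`. -/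
def poleOp (p m : ℕ) (z : ℂ) : HardyH2 p m →L[ℂ] HardyH2 p m :=
  if hz : z ∈ leftHalfPlane then (mulPole z hz).mkContinuous _ (norm_mulPole_le z hz) else 0

lemma poleOp_apply {z : ℂ} (hz : z ∈ leftHalfPlane) (F : HardyH2 p m) (s : CPlus) :
    (poleOp p m z F).toFun s = ((s : ℂ) - z)⁻¹ • F.toFun s := by
  rw [poleOp, dif_pos hz]
  rfl

lemma norm_poleOp_le {z : ℂ} (hz : z ∈ leftHalfPlane) : ‖poleOp p m z‖ ≤ (-z.re)⁻¹ := by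
  have hz' : z.re < 0 := hz
  rw [poleOp, dif_pos hz]
  exact LinearMap.mkContinuous_norm_le _ (inv_nonneg.2 (by linarith)) _

/-- The resolvent identity, from which continuity, the derivative `poleOp²` and then smoothness in
the pole follow. -/
lemma poleOp_sub {z w : ℂ} (hz : z ∈ leftHalfPlane) (hw : w ∈ leftHalfPlane) :
    poleOp p m w - poleOp p m z = (w - z) • (poleOp p m w).comp (poleOp p m z) := by
  refine ContinuousLinearMap.ext fun F => HardyH2.ext fun s => ?_
  simp only [sub_apply, smul_apply,
    ContinuousLinearMap.comp_apply, HardyH2.toFun_sub, HardyH2.toFun_smul, poleOp_apply hz,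
    poleOp_apply hw, smul_smul, ← sub_smul]
  congr 1
  have h1 := sub_ne_zero_of_re_neg hz s
  have h2 := sub_ne_zero_of_re_neg hw s
  field_simp
  ring

lemma tendsto_poleOp {z : ℂ} (hz : z ∈ leftHalfPlane) :
    Filter.Tendsto (poleOp p m) (nhds z) (nhds (poleOp p m z)) := by
  rw [tendsto_iff_norm_sub_tendsto_zero]
  have hz' : z.re < 0 := hz
  have hlim : Filter.Tendsto (fun w : ℂ => ‖w - z‖ * ((-w.re)⁻¹ * ‖poleOp p m z‖)) (nhds z)
      (nhds 0) := by
    have : ContinuousAt (fun w : ℂ => ‖w - z‖ * ((-w.re)⁻¹ * ‖poleOp p m z‖)) z := by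
      refine ContinuousAt.mul (by fun_prop) (ContinuousAt.mul (ContinuousAt.inv₀ ?_ ?_)
        continuousAt_const)
      · exact Complex.continuous_re.neg.continuousAt
      · linarith
    simpa [ContinuousAt] using this
  refine squeeze_zero' (.of_forall fun w => norm_nonneg _) ?_ hlim
  filter_upwards [isOpen_leftHalfPlane.mem_nhds hz] with w hw
  rw [poleOp_sub hz hw, norm_smul]
  refine mul_le_mul_of_nonneg_left ?_ (norm_nonneg _)
  exact (ContinuousLinearMap.opNorm_comp_le _ _).trans
    (mul_le_mul_of_nonneg_right (norm_poleOp_le hw) (norm_nonneg _))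

lemma hasDerivAt_poleOp {z : ℂ} (hz : z ∈ leftHalfPlane) :
    HasDerivAt (poleOp p m) ((poleOp p m z).comp (poleOp p m z)) z := by
  rw [hasDerivAt_iff_tendsto_slope]
  have h : Filter.Tendsto (fun w => (poleOp p m w).comp (poleOp p m z)) (nhdsWithin z {z}ᶜ)
      (nhds ((poleOp p m z).comp (poleOp p m z))) :=
    ((continuous_id.clm_comp continuous_const).tendsto _).comp
      ((tendsto_poleOp hz).mono_left nhdsWithin_le_nhds)
  refine h.congr' ?_
  filter_upwards [self_mem_nhdsWithin,
    nhdsWithin_le_nhds (isOpen_leftHalfPlane.mem_nhds hz)] with w hwz hw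
  rw [slope, vsub_eq_sub, poleOp_sub hz hw, inv_smul_smul₀ (sub_ne_zero.2 hwz)]

/-- The derivative is the operator composed with itself, so `C^n` implies `C^(n+1)`. -/
lemma contDiffOn_poleOp : ContDiffOn ℂ ∞ (poleOp p m) leftHalfPlane := by
  refine contDiffOn_infty.2 fun n => ?_
  induction n with
  | zero =>
    exact contDiffOn_zero.2 fun z hz => (hasDerivAt_poleOp hz).continuousAt.continuousWithinAt
  | succ n ih =>
    rw [Nat.cast_succ, contDiffOn_succ_iff_deriv_of_isOpen isOpen_leftHalfPlane]
    refine ⟨fun z hz => (hasDerivAt_poleOp hz).differentiableAt.differentiableWithinAt,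
      fun h => absurd h (by simp), ?_⟩
    exact (ih.clm_comp ih).congr fun z hz => (hasDerivAt_poleOp hz).deriv

lemma memLp_inv_one_add_mul_I :
    MeasureTheory.MemLp (fun y : ℝ => (1 + y * Complex.I)⁻¹) 2 MeasureTheory.volume := by
  have hne : ∀ y : ℝ, (1 + y * Complex.I) ≠ 0 := fun y h => by
    simpa using congrArg Complex.re h
  have hc : Continuous fun y : ℝ => (1 + y * Complex.I)⁻¹ :=
    Continuous.inv₀ (by fun_prop) hne
  rw [MeasureTheory.memLp_two_iff_integrable_sq_norm hc.aestronglyMeasurable]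
  refine integrable_inv_one_add_sq.congr (.of_forall fun y => ?_)
  simp only [norm_inv, inv_pow, Complex.sq_norm, Complex.normSq_apply]
  simp [sq]

lemma hardyENorm_inv_add_one_lt_top (M : Matrix (Fin p) (Fin m) ℂ) :
    hardyENorm (fun s : CPlus => ((s : ℂ) - (-1))⁻¹ • M) < ⊤ := by
  -- Since `|ξ + 1 + iy| ≥ |1 + iy|` for `ξ > 0`, every vertical line is dominated by the single
  -- function `1 / (1 + iy)`, whose squared modulus is `1 / (1 + y²)`.
  refine lt_of_le_of_lt (iSup_le fun ξ => ?_)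
    (ENNReal.mul_lt_top (a := ENNReal.ofReal ‖frob M‖) ENNReal.ofReal_lt_top
      memLp_inv_one_add_mul_I.2)
  refine MeasureTheory.eLpNorm_le_mul_eLpNorm_of_ae_le_mul (.of_forall fun y => ?_) 2
  rw [frob_smul, norm_smul, mul_comm]
  refine mul_le_mul_of_nonneg_left ?_ (norm_nonneg _)
  have hξ : (0 : ℝ) < ξ := ξ.2
  rw [norm_inv, norm_inv]
  refine inv_anti₀ (norm_pos_iff.2 fun h => by simpa using congrArg Complex.re h) ?_
  refine (sq_le_sq₀ (norm_nonneg _) (norm_nonneg _)).1 ?_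
  simp only [Complex.sq_norm, Complex.normSq_apply, vline]
  simp
  nlinarith

lemma neg_one_mem_leftHalfPlane : (-1 : ℂ) ∈ leftHalfPlane := by
  change (-1 : ℂ).re < 0
  simp

/-- `M / (s + 1)` as an element of the Hardy space. -/
def basePole (M : Matrix (Fin p) (Fin m) ℂ) : HardyH2 p m :=
  (⟨fun s => ((s : ℂ) - (-1))⁻¹ • M, IsAnalytic.inv_sub_smul (F := fun _ => M)
    neg_one_mem_leftHalfPlane ⟨fun _ => M, fun _ _ => differentiableOn_const _, fun _ => rfl⟩,
    hardyENorm_inv_add_one_lt_top M⟩ : hardySubmodule p m)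

/-- `M / (s - z)` as an element of the Hardy space, for `z` in the left half-plane. -/
def simplePole (M : Matrix (Fin p) (Fin m) ℂ) (z : ℂ) : HardyH2 p m :=
  -- Nonzero constants are not in the Hardy space, so `poleOp` acts on `M / (s + 1)`, using `1/(s -
  -- z) = 1/(s + 1) + (z + 1)/((s - z)(s + 1))`.
  basePole M + (z + 1) • poleOp p m z (basePole M)

lemma simplePole_apply (M : Matrix (Fin p) (Fin m) ℂ) {z : ℂ} (hz : z ∈ leftHalfPlane)
    (s : CPlus) : (simplePole M z).toFun s = ((s : ℂ) - z)⁻¹ • M := by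
  have hb : (basePole M).toFun s = ((s : ℂ) - (-1))⁻¹ • M := rfl
  rw [simplePole, HardyH2.toFun_add, HardyH2.toFun_smul, poleOp_apply hz, hb, smul_smul,
    smul_smul, ← add_smul]
  congr 1
  have h1 := sub_ne_zero_of_re_neg hz s
  have h2 := sub_ne_zero_of_re_neg neg_one_mem_leftHalfPlane s
  field_simp
  ring

lemma contDiffOn_simplePole (M : Matrix (Fin p) (Fin m) ℂ) :
    ContDiffOn ℂ ∞ (simplePole M) leftHalfPlane :=
  contDiffOn_const.add ((contDiffOn_id.add contDiffOn_const).smul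
    (contDiffOn_poleOp.clm_apply contDiffOn_const))

/-! ### The span of the tangent directions -/

/-- The span of the functions `e_j b_i^* / (s - lam_i)`, `c_i e_l^* / (s - lam_i)` and
`c_i b_i^* / (s - lam_i)²`. -/
def poleSpan (lam : Fin r → ℂ) (b : Fin r → Fin m → ℂ) (c : Fin r → Fin p → ℂ) :
    Submodule ℂ (CPlus → Matrix (Fin p) (Fin m) ℂ) :=
  Submodule.span ℂ
    ((Set.range fun ij : Fin r × Fin p => residueLeft lam b ij.1 ij.2) ∪
      (Set.range fun il : Fin r × Fin m => residueRight lam c il.1 il.2) ∪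
      Set.range (doublePole lam b c))

variable {lam : Fin r → ℂ} {b : Fin r → Fin m → ℂ} {c : Fin r → Fin p → ℂ}

lemma sum_smul_residueLeft (i : Fin r) (q : Fin p → ℂ) (s : CPlus) :
    (∑ j, q j • residueLeft lam b i j) s =
      ((s : ℂ) - lam i)⁻¹ • Matrix.vecMulVec q (star (b i)) := by
  ext j l
  simp [Finset.sum_apply, Matrix.sum_apply, residueLeft, Matrix.vecMulVec_apply, Pi.single_apply]
  ring

lemma sum_smul_residueRight (i : Fin r) (w : Fin m → ℂ) (s : CPlus) :
    (∑ l, w l • residueRight lam c i l) s =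
      ((s : ℂ) - lam i)⁻¹ • Matrix.vecMulVec (c i) w := by
  ext j l
  simp [Finset.sum_apply, Matrix.sum_apply, residueRight, Matrix.vecMulVec_apply,
    Pi.single_apply]
  ring

lemma left_mem_poleSpan (i : Fin r) (q : Fin p → ℂ) :
    (fun s : CPlus => ((s : ℂ) - lam i)⁻¹ • Matrix.vecMulVec q (star (b i)))
      ∈ poleSpan lam b c := by
  rw [← funext (sum_smul_residueLeft i q)]
  exact Submodule.sum_mem _ fun j _ => Submodule.smul_mem _ _
    (Submodule.subset_span (Or.inl (Or.inl ⟨(i, j), rfl⟩)))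

lemma right_mem_poleSpan (i : Fin r) (w : Fin m → ℂ) :
    (fun s : CPlus => ((s : ℂ) - lam i)⁻¹ • Matrix.vecMulVec (c i) w) ∈ poleSpan lam b c := by
  rw [← funext (sum_smul_residueRight i w)]
  exact Submodule.sum_mem _ fun l _ => Submodule.smul_mem _ _
    (Submodule.subset_span (Or.inl (Or.inr ⟨(i, l), rfl⟩)))

lemma doublePole_mem_poleSpan (i : Fin r) : doublePole lam b c i ∈ poleSpan lam b c :=
  Submodule.subset_span (Or.inr ⟨i, rfl⟩)

/-- Partial fractions. -/
lemma cross_mem_poleSpan (hlam : Function.Injective lam) (hre : ∀ i, (lam i).re < 0)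
    (i k : Fin r) (a d : ℂ) :
    (fun s : CPlus => (((s : ℂ) - lam i)⁻¹ * ((s : ℂ) - lam k)⁻¹ * (s * a - d)) •
      Matrix.vecMulVec (c i) (star (b k))) ∈ poleSpan lam b c := by
  by_cases hik : i = k
  · subst hik
    have h := (poleSpan lam b c).add_mem
      ((poleSpan lam b c).smul_mem a (right_mem_poleSpan (c := c) i (star (b i))))
      ((poleSpan lam b c).smul_mem (lam i * a - d) (doublePole_mem_poleSpan i))
    convert h using 1
    funext s
    have hs := sub_ne_zero_of_re_neg (hre i) s
    simp only [Pi.add_apply, Pi.smul_apply, doublePole, smul_smul, ← add_smul]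
    congr 1
    field_simp
    ring
  · have hd : lam i - lam k ≠ 0 := sub_ne_zero.2 fun h => hik (hlam h)
    -- The coefficients are the residues at the two poles. The mixed matrix `c_i b_k^*` is
    -- admissible at both: at `lam i` its left factor is `c_i`, at `lam k` its right factor is
    -- `b_k^*`.
    have h := (poleSpan lam b c).add_mem
      ((poleSpan lam b c).smul_mem ((lam i * a - d) / (lam i - lam k))
        (right_mem_poleSpan (c := c) i (star (b k))))
      ((poleSpan lam b c).smul_mem (-(lam k * a - d) / (lam i - lam k))
        (left_mem_poleSpan (b := b) k (c i)))
    convert h using 1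
    funext s
    have hs := sub_ne_zero_of_re_neg (hre i) s
    have hs' := sub_ne_zero_of_re_neg (hre k) s
    simp only [Pi.add_apply, Pi.smul_apply, smul_smul, ← add_smul]
    congr 1
    field_simp
    ring

lemma exists_of_mem_poleSpan {f : CPlus → Matrix (Fin p) (Fin m) ℂ}
    (hf : f ∈ poleSpan lam b c) :
    ∃ (x : Fin r → Fin p → ℂ) (y : Fin r → Fin m → ℂ) (a : Fin r → ℂ), ∀ s : CPlus,
      f s = ∑ i, (((s : ℂ) - lam i)⁻¹ • (Matrix.vecMulVec (x i) (star (b i)) +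
        Matrix.vecMulVec (c i) (star (y i))) +
        (a i * (((s : ℂ) - lam i) ^ 2)⁻¹) • Matrix.vecMulVec (c i) (star (b i))) := by
  rw [poleSpan, Submodule.span_union, Submodule.span_union] at hf
  obtain ⟨f₁, h₁, f₂, h₂, rfl⟩ := Submodule.mem_sup.1 hf
  obtain ⟨f₃, h₃, f₄, h₄, rfl⟩ := Submodule.mem_sup.1 h₁
  obtain ⟨x, rfl⟩ := (Submodule.mem_span_range_iff_exists_fun ℂ).1 h₃
  obtain ⟨y, rfl⟩ := (Submodule.mem_span_range_iff_exists_fun ℂ).1 h₄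
  obtain ⟨a, rfl⟩ := (Submodule.mem_span_range_iff_exists_fun ℂ).1 h₂
  -- The `y i` are conjugated because they enter through an adjoint, while the span coefficients
  -- enter linearly.
  refine ⟨fun i j => x (i, j), fun i => star fun l => y (i, l), a, fun s => ?_⟩
  simp only [smul_add, star_star, ← sum_smul_residueLeft, ← sum_smul_residueRight]
  simp only [Finset.sum_add_distrib, Fintype.sum_prod_type, Pi.add_apply, Finset.sum_apply,
    Pi.smul_apply, doublePole, smul_smul]

/-! ### Velocities of curves of stable rational functions -/

/-- Finitely many proper hyperplanes do not cover `ℂ^n`. Applied to the `c_i` and to the `b_i^*`,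
this gives directions in which the scalar function `x H y` keeps all `r` poles. -/
lemma exists_dotProduct_ne_zero {n : ℕ} (v : Fin r → Fin n → ℂ) (hv : ∀ i, v i ≠ 0) :
    ∃ x : Fin n → ℂ, ∀ i, x ⬝ᵥ v i ≠ 0 := by
  obtain ⟨f, hf⟩ := Module.exists_dual_forall_apply_ne_zero (K := ℂ) v hv
  refine ⟨fun j => f (Pi.single j 1), fun i => ?_⟩
  have h := LinearMap.pi_apply_eq_sum_univ f (v i)
  convert hf i using 1
  rw [h, dotProduct]
  refine Finset.sum_congr rfl fun j _ => ?_
  rw [smul_eq_mul, mul_comm]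
  congr 2
  funext k
  simp [Pi.single_apply, eq_comm]

lemma isUnit_diagonal_of_ne_zero {d : Fin r → ℂ} (hd : ∀ i, d i ≠ 0) :
    IsUnit (Matrix.diagonal d) := by
  rw [Matrix.isUnit_iff_isUnit_det, Matrix.det_diagonal]
  exact (Finset.prod_ne_zero_iff.2 fun i _ => hd i).isUnit

/-- For a diagonal realization the matrix is a Cauchy matrix times a diagonal one with entries `x ⬝ᵥ
c k`. -/
lemma isUnit_obsMatrix (hlam : Function.Injective lam) (hre : ∀ i, (lam i).re < 0)
    {sig : Fin r → CPlus} (hsig : Function.Injective fun i => (sig i : ℂ)) {x : Fin p → ℂ}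
    (hx : ∀ i, x ⬝ᵥ c i ≠ 0) :
    IsUnit (obsMatrix sig x (Matrix.diagonal lam) (outputMatrix c)) := by
  have h : obsMatrix sig x (Matrix.diagonal lam) (outputMatrix c) =
      (Matrix.of fun i k => ((sig i : ℂ) - lam k)⁻¹) * Matrix.diagonal fun k => x ⬝ᵥ c k := by
    ext i k
    rw [obsMatrix, Matrix.of_apply,
      inv_smul_one_sub_diagonal fun k => ne_of_re_neg (sig i).2 (hre k), ← Matrix.vecMul_vecMul,
      Matrix.vecMul_diagonal, Matrix.mul_diagonal, Matrix.of_apply, mul_comm]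
    rfl
  rw [h]
  exact (isUnit_cauchy hlam hsig fun i k => ne_of_re_neg (sig i).2 (hre k)).mul
    (isUnit_diagonal_of_ne_zero hx)

lemma isUnit_ctrlMatrix (hlam : Function.Injective lam) (hre : ∀ i, (lam i).re < 0)
    {mu : Fin r → CPlus} (hmu : Function.Injective fun i => (mu i : ℂ)) {y : Fin m → ℂ}
    (hy : ∀ i, y ⬝ᵥ star (b i) ≠ 0) :
    IsUnit (ctrlMatrix mu y (Matrix.diagonal lam) (inputMatrix b)) := by
  have h : ctrlMatrix mu y (Matrix.diagonal lam) (inputMatrix b) =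
      (Matrix.diagonal fun k => y ⬝ᵥ star (b k)) *
        (Matrix.of fun i k => ((mu i : ℂ) - lam k)⁻¹).transpose := by
    ext k j
    rw [ctrlMatrix, Matrix.of_apply,
      inv_smul_one_sub_diagonal fun k => ne_of_re_neg (mu j).2 (hre k), ← Matrix.mulVec_mulVec,
      Matrix.mulVec_diagonal, Matrix.diagonal_mul, Matrix.transpose_apply, Matrix.of_apply,
      mul_comm, dotProduct_comm]
    rfl
  rw [h]
  exact (isUnit_diagonal_of_ne_zero hy).mul ((Matrix.isUnit_transpose _).2
    (isUnit_cauchy hlam hmu fun i k => ne_of_re_neg (mu i).2 (hre k)))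

lemma output_mul_diagonal_mul (d : Fin r → ℂ) (P : Matrix (Fin r) (Fin m) ℂ) :
    outputMatrix c * Matrix.diagonal d * P = ∑ i, d i • Matrix.vecMulVec (c i) (P i) := by
  ext j l
  rw [Matrix.mul_apply, Matrix.sum_apply]
  refine Finset.sum_congr rfl fun i _ => ?_
  simp [Matrix.mul_diagonal, outputMatrix, Matrix.vecMulVec_apply]
  ring

lemma mul_diagonal_mul_input (d : Fin r → ℂ) (Q : Matrix (Fin p) (Fin r) ℂ) :
    Q * Matrix.diagonal d * inputMatrix b =
      ∑ i, d i • Matrix.vecMulVec (fun j => Q j i) (star (b i)) := by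
  ext j l
  rw [Matrix.mul_apply, Matrix.sum_apply]
  refine Finset.sum_congr rfl fun i _ => ?_
  simp [Matrix.mul_diagonal, inputMatrix, Matrix.vecMulVec_apply]
  ring

lemma output_mul_mul_input (d : Fin r → ℂ) (Z : Matrix (Fin r) (Fin r) ℂ) :
    outputMatrix c * Matrix.diagonal d * Z * (Matrix.diagonal d * inputMatrix b) =
      ∑ i, ∑ k, (d i * d k * Z i k) • Matrix.vecMulVec (c i) (star (b k)) := by
  ext j l
  rw [Matrix.mul_apply, Matrix.sum_apply]
  simp only [Matrix.sum_apply, Matrix.mul_apply (M := outputMatrix c * Matrix.diagonal d),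
    Finset.sum_mul]
  rw [Finset.sum_comm]
  refine Finset.sum_congr rfl fun i _ => Finset.sum_congr rfl fun k _ => ?_
  simp [Matrix.mul_diagonal, Matrix.diagonal_mul, inputMatrix, outputMatrix,
    Matrix.vecMulVec_apply]
  ring

/-- A function `C D P + Q D B - C D (s X - Y) D B`, where `D = (s - Λ)⁻¹`, is a tangent
direction. -/
lemma mem_poleSpan_of_eq (hlam : Function.Injective lam) (hre : ∀ i, (lam i).re < 0)
    {f : CPlus → Matrix (Fin p) (Fin m) ℂ} (P : Matrix (Fin r) (Fin m) ℂ)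
    (Q : Matrix (Fin p) (Fin r) ℂ) (X Y : Matrix (Fin r) (Fin r) ℂ)
    (hf : ∀ s : CPlus, f s =
      outputMatrix c * Matrix.diagonal (fun i => ((s : ℂ) - lam i)⁻¹) * P +
      Q * Matrix.diagonal (fun i => ((s : ℂ) - lam i)⁻¹) * inputMatrix b -
      outputMatrix c * Matrix.diagonal (fun i => ((s : ℂ) - lam i)⁻¹) * ((s : ℂ) • X - Y) *
        (Matrix.diagonal (fun i => ((s : ℂ) - lam i)⁻¹) * inputMatrix b)) :
    f ∈ poleSpan lam b c := by
  have e : f = (∑ i, fun s : CPlus => ((s : ℂ) - lam i)⁻¹ • Matrix.vecMulVec (c i) (P i)) +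
      (∑ i, fun s : CPlus => ((s : ℂ) - lam i)⁻¹ •
        Matrix.vecMulVec (fun j => Q j i) (star (b i))) -
      ∑ i, ∑ k, fun s : CPlus => (((s : ℂ) - lam i)⁻¹ * ((s : ℂ) - lam k)⁻¹ *
        (s * X i k - Y i k)) • Matrix.vecMulVec (c i) (star (b k)) := by
    funext s
    rw [hf, output_mul_diagonal_mul, mul_diagonal_mul_input, output_mul_mul_input]
    simp [Finset.sum_apply]
  rw [e]
  exact Submodule.sub_mem _ (Submodule.add_mem _
    (Submodule.sum_mem _ fun i _ => right_mem_poleSpan i _)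
    (Submodule.sum_mem _ fun i _ => left_mem_poleSpan i _))
    (Submodule.sum_mem _ fun i _ => Submodule.sum_mem _ fun k _ =>
      cross_mem_poleSpan hlam hre i k _ _)

section curve

variable {G : ℝ → CPlus → Matrix (Fin p) (Fin m) ℂ} {v : CPlus → Matrix (Fin p) (Fin m) ℂ}

lemma hasDerivAt_mulVec (hG : ∀ s j l, HasDerivAt (fun t => G t s j l) (v s j l) 0)
    (y : Fin m → ℂ) (s : CPlus) (j : Fin p) :
    HasDerivAt (fun t => (G t s).mulVec y j) ((v s).mulVec y j) 0 := by
  simp only [Matrix.mulVec, dotProduct]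
  exact HasDerivAt.fun_sum fun l _ => (hG s j l).mul_const _

lemma hasDerivAt_vecMul (hG : ∀ s j l, HasDerivAt (fun t => G t s j l) (v s j l) 0)
    (x : Fin p → ℂ) (s : CPlus) (l : Fin m) :
    HasDerivAt (fun t => Matrix.vecMul x (G t s) l) (Matrix.vecMul x (v s) l) 0 := by
  simp only [Matrix.vecMul, dotProduct]
  exact HasDerivAt.fun_sum fun j _ => (hG s j l).const_mul _

lemma hasDerivAt_dotProduct_mulVec (hG : ∀ s j l, HasDerivAt (fun t => G t s j l) (v s j l) 0)
    (x : Fin p → ℂ) (y : Fin m → ℂ) (s : CPlus) :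
    HasDerivAt (fun t => x ⬝ᵥ (G t s).mulVec y) (x ⬝ᵥ (v s).mulVec y) 0 := by
  simp only [dotProduct]
  exact HasDerivAt.fun_sum fun j _ => (hasDerivAt_mulVec hG y s j).const_mul _

lemma hasDerivAt_loewner (hG : ∀ s j l, HasDerivAt (fun t => G t s j l) (v s j l) 0)
    (sig mu : Fin r → CPlus) (x : Fin p → ℂ) (y : Fin m → ℂ) (i j : Fin r) :
    HasDerivAt (fun t => loewner sig mu x y (G t) i j) (loewner sig mu x y v i j) 0 :=
  ((hasDerivAt_dotProduct_mulVec hG x y _).sub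
    (hasDerivAt_dotProduct_mulVec hG x y _)).const_mul _

lemma hasDerivAt_loewnerPencil (hG : ∀ s j l, HasDerivAt (fun t => G t s j l) (v s j l) 0)
    (sig mu : Fin r → CPlus) (x : Fin p → ℂ) (y : Fin m → ℂ) (s : ℂ) (i j : Fin r) :
    HasDerivAt (fun t => loewnerPencil sig mu x y (G t) s i j)
      (loewnerPencil sig mu x y v s i j) 0 :=
  ((hasDerivAt_loewner hG sig mu x y i j).const_mul _).add
    (hasDerivAt_dotProduct_mulVec hG x y _)

lemma exists_points (r : ℕ) : ∃ sig mu : Fin r → CPlus,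
    (Function.Injective fun i => (sig i : ℂ)) ∧ (Function.Injective fun i => (mu i : ℂ)) ∧
      ∀ i j, (sig i : ℂ) ≠ mu j := by
  have hpos : ∀ n : ℕ, ((n : ℂ) + 1) ∈ CPlus := fun n => by
    change 0 < ((n : ℂ) + 1).re
    simp only [Complex.add_re, Complex.natCast_re, Complex.one_re]
    positivity
  refine ⟨fun i => ⟨((i : ℕ) : ℂ) + 1, hpos _⟩, fun j => ⟨((r + j : ℕ) : ℂ) + 1, hpos _⟩,
    fun i j h => ?_, fun i j h => ?_, fun i j h => ?_⟩
  · exact Fin.ext (by exact_mod_cast add_right_cancel h)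
  · have : r + (i : ℕ) = r + j := by exact_mod_cast add_right_cancel h
    exact Fin.ext (by omega)
  · have : (i : ℕ) = r + j := by exact_mod_cast add_right_cancel h
    have := i.2
    omega

/-- The velocity of a curve in `Σ⁻` through a pole-residue form with distinct poles. -/
lemma velocity_mem_poleSpan (hlam : Function.Injective lam) (hre : ∀ i, (lam i).re < 0)
    (hb : ∀ i, b i ≠ 0) (hc : ∀ i, c i ≠ 0)
    (hG : ∀ s j l, HasDerivAt (fun t => G t s j l) (v s j l) 0)
    (hmem : ∀ᶠ t in nhds (0 : ℝ), G t ∈ stableRat r m p)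
    (hG0 : ∀ s : CPlus, G 0 s =
      ∑ i, ((s : ℂ) - lam i)⁻¹ • Matrix.vecMulVec (c i) (star (b i))) :
    v ∈ poleSpan lam b c := by
  obtain ⟨sig, mu, hsig, hmu, hne⟩ := exists_points r
  obtain ⟨x, hx⟩ := exists_dotProduct_ne_zero c hc
  obtain ⟨y, hy⟩ := exists_dotProduct_ne_zero (fun i => star (b i))
    fun i => star_ne_zero.2 (hb i)
  have hA : IsHurwitz (Matrix.diagonal lam) := fun z hz => by
    rw [spectrum_diagonal_eq] at hz
    obtain ⟨i, rfl⟩ := hz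
    exact hre i
  have hF : ∀ s : CPlus, G 0 s =
      transfer (Matrix.diagonal lam) (inputMatrix b) (outputMatrix c) s := fun s =>
    (hG0 s).trans (transfer_diagonal b c fun i => ne_of_re_neg s.2 (hre i)).symm
  set O := obsMatrix sig x (Matrix.diagonal lam) (outputMatrix c) with hO
  set R := ctrlMatrix mu y (Matrix.diagonal lam) (inputMatrix b) with hR
  have hOu : IsUnit O := isUnit_obsMatrix hlam hre hsig hx
  have hRu : IsUnit R := isUnit_ctrlMatrix hlam hre hmu hy
  have hL0 : IsUnit (loewner sig mu x y (G 0)) := by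
    rw [← obsMatrix_mul_ctrlMatrix hA hF hne]
    exact hOu.mul hRu
  -- The determinant of the Loewner matrix is continuous along the curve, so the reconstruction
  -- formula persists for small `t`.
  have hLev : ∀ᶠ t in nhds (0 : ℝ), IsUnit (loewner sig mu x y (G t)) := by
    have hcont : ContinuousAt (fun t => loewner sig mu x y (G t)) 0 :=
      continuousAt_pi.2 fun i => continuousAt_pi.2 fun k =>
        (hasDerivAt_loewner hG sig mu x y i k).continuousAt
    have hdet : ContinuousAt (fun t => (loewner sig mu x y (G t)).det) 0 :=
      (continuous_id.matrix_det.tendsto (loewner sig mu x y (G 0))).comp hcont.tendsto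
    filter_upwards [hdet.eventually_ne ((Matrix.isUnit_iff_isUnit_det _).1 hL0).ne_zero] with t ht
    exact (Matrix.isUnit_iff_isUnit_det _).2 ht.isUnit
  -- The four matrices do not depend on `s`. The pencil of `v` is affine in `s`, and its two
  -- coefficients give `X` and `Y` after multiplication by `O⁻¹` and `R⁻¹`.
  refine mem_poleSpan_of_eq hlam hre (O⁻¹ * leftData sig x v) (rightData mu y v * R⁻¹)
    (O⁻¹ * loewner sig mu x y v * R⁻¹)
    (O⁻¹ * (Matrix.of fun i j => sig i * loewner sig mu x y v i j -
      x ⬝ᵥ (v (mu j)).mulVec y) * R⁻¹) fun s => ?_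
  obtain ⟨hX0, hinv, -⟩ := eq_rightData_mul_inv_mul_leftData hA hF hne hL0 s
  have key := derivative_mul_inv_mul (G := fun t => G t s) (G' := v s)
    (W := fun t => rightData mu y (G t)) (W' := rightData mu y v)
    (X := fun t => loewnerPencil sig mu x y (G t) s) (X' := loewnerPencil sig mu x y v s)
    (V := fun t => leftData sig x (G t)) (V' := leftData sig x v)
    (fun i j => hasDerivAt_mulVec hG y (mu j) i)
    (fun i j => hasDerivAt_loewnerPencil hG sig mu x y s i j)
    (fun i j => hasDerivAt_vecMul hG x (sig i) j) (fun i j => hG s i j) hX0 (by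
      filter_upwards [hmem, hLev] with t ht hLt
      obtain ⟨A, B, C, hA', -, hABC⟩ := ht
      have := eq_rightData_mul_inv_mul_leftData hA' hABC hne hLt s
      exact ⟨this.1, this.2.2⟩)
  have hD := inv_smul_one_sub_diagonal fun i => ne_of_re_neg s.2 (hre i)
  have hpencil : loewnerPencil sig mu x y v s = (s : ℂ) • loewner sig mu x y v -
      Matrix.of fun i j => sig i * loewner sig mu x y v i j - x ⬝ᵥ (v (mu j)).mulVec y := by
    ext i j
    simp only [loewnerPencil, Matrix.of_apply, Matrix.sub_apply, Matrix.smul_apply, smul_eq_mul]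
    ring
  have hu : rightData mu y (G 0) * (loewnerPencil sig mu x y (G 0) s)⁻¹ =
      outputMatrix c * Matrix.diagonal (fun i => ((s : ℂ) - lam i)⁻¹) * O⁻¹ := by
    rw [hinv, ← output_mul_ctrlMatrix hF, hD]
    simp only [Matrix.mul_assoc]
    rw [Matrix.mul_nonsing_inv_cancel_left _ _ ((Matrix.isUnit_iff_isUnit_det _).1 hRu)]
  have hw : (loewnerPencil sig mu x y (G 0) s)⁻¹ * leftData sig x (G 0) =
      R⁻¹ * (Matrix.diagonal (fun i => ((s : ℂ) - lam i)⁻¹) * inputMatrix b) := by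
    rw [hinv, ← obsMatrix_mul_input hF, hD]
    simp only [Matrix.mul_assoc]
    rw [Matrix.nonsing_inv_mul_cancel_left _ _ ((Matrix.isUnit_iff_isUnit_det _).1 hOu)]
  simp only [hu, hw, hpencil] at key
  rw [key]
  simp only [Matrix.mul_assoc, Matrix.mul_sub, Matrix.sub_mul, Matrix.mul_smul, Matrix.smul_mul]

end curve

/-! ### Curves with a given velocity -/

lemma toFun_finset_sum {ι : Type*} (S : Finset ι) (F : ι → HardyH2 p m) (s : CPlus) :
    (∑ i ∈ S, F i).toFun s = ∑ i ∈ S, (F i).toFun s := by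
  classical
  induction S using Finset.induction_on with
  | empty => rfl
  | insert a S ha ih => rw [Finset.sum_insert ha, Finset.sum_insert ha, HardyH2.toFun_add, ih]

/-- The curve `(M₀ + t M₁ + t² M₂) / (s - z - t a)`. -/
def movingPole (M₀ M₁ M₂ : Matrix (Fin p) (Fin m) ℂ) (z a : ℂ) (t : ℝ) : HardyH2 p m :=
  simplePole M₀ (z + t * a) + t • simplePole M₁ (z + t * a) + t ^ 2 • simplePole M₂ (z + t * a)

lemma movingPole_apply (M₀ M₁ M₂ : Matrix (Fin p) (Fin m) ℂ) {z a : ℂ} {t : ℝ}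
    (h : z + t * a ∈ leftHalfPlane) (s : CPlus) :
    (movingPole M₀ M₁ M₂ z a t).toFun s =
      ((s : ℂ) - (z + t * a))⁻¹ • (M₀ + (t : ℂ) • M₁ + (t ^ 2 : ℂ) • M₂) := by
  have e : (movingPole M₀ M₁ M₂ z a t).toFun s = (simplePole M₀ (z + t * a)).toFun s +
      (t : ℂ) • (simplePole M₁ (z + t * a)).toFun s +
      ((t ^ 2 : ℝ) : ℂ) • (simplePole M₂ (z + t * a)).toFun s := rfl
  rw [e, simplePole_apply _ h, simplePole_apply _ h, simplePole_apply _ h]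
  push_cast
  rw [smul_add, smul_add, smul_comm (t : ℂ), smul_comm ((t : ℂ) ^ 2)]

lemma contDiffOn_movingPole (M₀ M₁ M₂ : Matrix (Fin p) (Fin m) ℂ) {z a : ℂ} {S : Set ℝ}
    (h : ∀ t ∈ S, z + (t : ℂ) * a ∈ leftHalfPlane) :
    ContDiffOn ℝ ∞ (movingPole M₀ M₁ M₂ z a) S := by
  have hz : ContDiff ℝ ∞ fun t : ℝ => z + (t : ℂ) * a :=
    contDiff_const.add (Complex.ofRealCLM.contDiff.mul contDiff_const)
  have hp : ∀ M : Matrix (Fin p) (Fin m) ℂ,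
      ContDiffOn ℝ ∞ (fun t : ℝ => simplePole M (z + (t : ℂ) * a)) S := fun M =>
    ((contDiffOn_simplePole M).restrict_scalars ℝ).comp hz.contDiffOn h
  exact ((hp M₀).add (contDiffOn_id.smul (hp M₁))).add ((contDiffOn_id.pow 2).smul (hp M₂))

lemma hasDerivAt_movingPole_entry (M₀ M₁ M₂ : Matrix (Fin p) (Fin m) ℂ) {z a s : ℂ}
    (hs : s - z ≠ 0) (j : Fin p) (l : Fin m) :
    HasDerivAt (fun t : ℝ => ((s - (z + t * a))⁻¹ •
        (M₀ + (t : ℂ) • M₁ + (t ^ 2 : ℂ) • M₂)) j l)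
      (((s - z)⁻¹ • M₁ + (a * ((s - z) ^ 2)⁻¹) • M₀) j l) 0 := by
  have ht : HasDerivAt (fun t : ℝ => (t : ℂ)) 1 0 := Complex.ofRealCLM.hasDerivAt
  have hd : HasDerivAt (fun t : ℝ => s - (z + t * a)) (-(1 * a)) 0 :=
    ((ht.mul_const a).const_add z).const_sub s
  have hn : HasDerivAt (fun t : ℝ => M₀ j l + (t : ℂ) * M₁ j l + (t ^ 2 : ℂ) * M₂ j l)
      (1 * M₁ j l + ((2 : ℕ) * ((0 : ℝ) : ℂ) ^ (2 - 1) * 1) * M₂ j l) 0 :=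
    ((ht.mul_const _).const_add _).add ((ht.pow 2).mul_const _)
  have h := (hd.fun_inv (by simpa using hs)).mul hn
  refine h.congr_deriv ?_
  simp only [Matrix.add_apply, Matrix.smul_apply, smul_eq_mul]
  simp
  ring

/-- Since `t` is real, conjugation leaves it unchanged; this supplies the three coefficients of
`movingPole`. -/
lemma vecMulVec_moving (c x : Fin p → ℂ) (b y : Fin m → ℂ) (t : ℝ) :
    Matrix.vecMulVec (c + (t : ℂ) • x) (star (b + (t : ℂ) • y)) =
      Matrix.vecMulVec c (star b) +
        (t : ℂ) • (Matrix.vecMulVec x (star b) + Matrix.vecMulVec c (star y)) +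
        (t ^ 2 : ℂ) • Matrix.vecMulVec x (star y) := by
  ext j l
  simp [Matrix.vecMulVec_apply]
  ring

/-- Every element of the span is the velocity of a smooth curve in `Σ⁻`. -/
lemma exists_curve (hlam : Function.Injective lam) (hre : ∀ i, (lam i).re < 0)
    (hb : ∀ i, b i ≠ 0) (hc : ∀ i, c i ≠ 0) {f : CPlus → Matrix (Fin p) (Fin m) ℂ}
    (hf : f ∈ poleSpan lam b c) {H' : HardyH2 p m}
    (hH' : ∀ s : CPlus, H'.toFun s =
      ∑ i, ((s : ℂ) - lam i)⁻¹ • Matrix.vecMulVec (c i) (star (b i))) :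
    ∃ v ∈ tangentSet (stableRatH2 r m p) H', v.toFun = f := by
  obtain ⟨x, y, a, hf⟩ := exists_of_mem_poleSpan hf
  have hcont : ∀ i, Continuous fun t : ℝ => lam i + (t : ℂ) * a i := fun i => by fun_prop
  -- Stability, distinctness of the poles and nonvanishing of the residue factors are open
  -- conditions that hold at `t = 0`.
  have h1 : ∀ᶠ t : ℝ in nhds 0, ∀ i, lam i + (t : ℂ) * a i ∈ leftHalfPlane :=
    Filter.eventually_all.2 fun i => (hcont i).continuousAt.eventually
      (isOpen_leftHalfPlane.mem_nhds (by simpa [leftHalfPlane] using hre i))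
  have h2 : ∀ᶠ t : ℝ in nhds 0, ∀ i k, i ≠ k → lam i + (t : ℂ) * a i ≠ lam k + (t : ℂ) * a k := by
    refine Filter.eventually_all.2 fun i => Filter.eventually_all.2 fun k => ?_
    by_cases hik : i = k
    · exact .of_forall fun t h => absurd hik h
    · have := ((hcont i).sub (hcont k)).continuousAt.eventually_ne (x := 0) (y := 0)
        (by simpa [sub_eq_zero] using fun h => hik (hlam h))
      exact this.mono fun t ht _ => sub_ne_zero.1 ht
  have h3 : ∀ᶠ t : ℝ in nhds 0, ∀ i, b i + (t : ℂ) • y i ≠ 0 :=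
    Filter.eventually_all.2 fun i => (by fun_prop : Continuous fun t : ℝ =>
      b i + (t : ℂ) • y i).continuousAt.eventually_ne (by simpa using hb i)
  have h4 : ∀ᶠ t : ℝ in nhds 0, ∀ i, c i + (t : ℂ) • x i ≠ 0 :=
    Filter.eventually_all.2 fun i => (by fun_prop : Continuous fun t : ℝ =>
      c i + (t : ℂ) • x i).continuousAt.eventually_ne (by simpa using hc i)
  obtain ⟨ε, hε, hball⟩ := Metric.eventually_nhds_iff_ball.1 (h1.and (h2.and (h3.and h4)))
  rw [Real.ball_eq_Ioo, zero_sub, zero_add] at hball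
  let γ : ℝ → HardyH2 p m := fun t => ∑ i, movingPole (Matrix.vecMulVec (c i) (star (b i)))
    (Matrix.vecMulVec (x i) (star (b i)) + Matrix.vecMulVec (c i) (star (y i)))
    (Matrix.vecMulVec (x i) (star (y i))) (lam i) (a i) t
  have hγ : ∀ t ∈ Set.Ioo (-ε) ε, ∀ s : CPlus, (γ t).toFun s =
      ∑ i, ((s : ℂ) - (lam i + t * a i))⁻¹ • (Matrix.vecMulVec (c i) (star (b i)) +
        (t : ℂ) • (Matrix.vecMulVec (x i) (star (b i)) + Matrix.vecMulVec (c i) (star (y i))) +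
        (t ^ 2 : ℂ) • Matrix.vecMulVec (x i) (star (y i))) := fun t ht s => by
    rw [toFun_finset_sum]
    exact Finset.sum_congr rfl fun i _ => movingPole_apply _ _ _ ((hball t ht).1 i) s
  have hsmooth : ContDiffOn ℝ ∞ γ (Set.Ioo (-ε) ε) :=
    ContDiffOn.sum fun i _ => contDiffOn_movingPole _ _ _ fun t ht => (hball t ht).1 i
  have h0 : (0 : ℝ) ∈ Set.Ioo (-ε) ε := ⟨by linarith, hε⟩
  -- Smoothness already supplies a derivative in the Hardy space; it is identified with `f` entry by
  -- entry through point evaluations.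
  have hderiv : HasDerivAt γ (deriv γ 0) 0 :=
    ((hsmooth.differentiableOn (by simp)).differentiableAt (Ioo_mem_nhds h0.1 h0.2)).hasDerivAt
  refine ⟨deriv γ 0, ⟨ε, γ, hε, hsmooth, fun t ht => ?_, ?_, hderiv⟩, ?_⟩
  · obtain ⟨g1, g2, g3, g4⟩ := hball t ht
    have hmem := poleResidue_mem_stableRat (r := r) (m := m) (p := p)
      (lam := fun i => lam i + t * a i) (fun i k h => by
        by_contra hik
        exact g2 i k hik h) g1 g3 g4
    change (γ t).toFun ∈ stableRat r m p
    convert hmem using 1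
    funext s
    rw [hγ t ht]
    simp only [vecMulVec_moving]
  · refine HardyH2.ext fun s => ?_
    rw [hγ 0 h0, hH']
    simp
  · funext s
    ext j l
    refine (hasDerivAt_apply hderiv s j l).unique ?_
    have h : HasDerivAt (fun t : ℝ => ∑ i, (((s : ℂ) - (lam i + t * a i))⁻¹ •
        (Matrix.vecMulVec (c i) (star (b i)) +
        (t : ℂ) • (Matrix.vecMulVec (x i) (star (b i)) + Matrix.vecMulVec (c i) (star (y i))) +
        (t ^ 2 : ℂ) • Matrix.vecMulVec (x i) (star (y i)))) j l) (f s j l) 0 := by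
      rw [hf, Matrix.sum_apply]
      exact HasDerivAt.fun_sum fun i _ => hasDerivAt_movingPole_entry _ _ _
        (sub_ne_zero_of_re_neg (hre i) s) j l
    refine h.congr_of_eventuallyEq ?_
    filter_upwards [Ioo_mem_nhds h0.1 h0.2] with t ht
    rw [hγ t ht, Matrix.sum_apply]

end StableRational

end

/-! ### The tangent space as a span. -/

open StableRational in
theorem mainTheorem6 (r m p : ℕ)
    (H : StableRational.CPlus → Matrix (Fin p) (Fin m) ℂ)
    (hH : H ∈ StableRational.stableRat r m p)
    (lam : Fin r → ℂ) (b : Fin r → Fin m → ℂ) (c : Fin r → Fin p → ℂ)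
    (hlam : Function.Injective lam)
    (hpr : ∀ s : StableRational.CPlus,
      H s = ∑ i, ((s : ℂ) - lam i)⁻¹ • Matrix.vecMulVec (c i) (star (b i))) :
    ∃ H' : StableRational.HardyH2 p m, H'.toFun = H ∧
      StableRational.HardyH2.toFun ''
          StableRational.tangentSet (StableRational.stableRatH2 r m p) H' =
        (Submodule.span ℂ
          ((Set.range fun ij : Fin r × Fin p => StableRational.residueLeft lam b ij.1 ij.2) ∪
            (Set.range fun il : Fin r × Fin m => StableRational.residueRight lam c il.1 il.2) ∪
            Set.range (StableRational.doublePole lam b c)) :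
          Set (StableRational.CPlus → Matrix (Fin p) (Fin m) ℂ)) := by
  have hst := stable_poles_of_mem_stableRat hH hlam hpr
  have hH' : ∀ s, (∑ i, simplePole (Matrix.vecMulVec (c i) (star (b i))) (lam i)).toFun s =
      ∑ i, ((s : ℂ) - lam i)⁻¹ • Matrix.vecMulVec (c i) (star (b i)) := fun s => by
    rw [toFun_finset_sum]
    exact Finset.sum_congr rfl fun i _ => simplePole_apply _ (hst i).1 s
  refine ⟨∑ i, simplePole (Matrix.vecMulVec (c i) (star (b i))) (lam i),
    funext fun s => (hH' s).trans (hpr s).symm, Set.Subset.antisymm ?_ fun f hf => ?_⟩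
  · rintro _ ⟨v, ⟨ε, γ, hε, -, hγ, hγ0, hd⟩, rfl⟩
    refine velocity_mem_poleSpan hlam (fun i => (hst i).1) (fun i => (hst i).2.1)
      (fun i => (hst i).2.2) (G := fun t => (γ t).toFun) (fun s j l => hasDerivAt_apply hd s j l)
      ?_ fun s => ?_
    · filter_upwards [Ioo_mem_nhds (neg_lt_zero.2 hε) hε] with t ht
      exact hγ t ht
    · simp only [hγ0, hH']
  · exact exists_curve hlam (fun i => (hst i).1) (fun i => (hst i).2.1) (fun i => (hst i).2.2)
      hf hH'
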